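/- Let $K$ be a compact Lie group with Lie algebra $\mathfrak k$, let $H\subset K$ be a closed subgroup with Lie algebra $\mathfrak h$, and let $Q$ be a biinvariant metric, regarded as an $\mathrm{Ad}_K$-invariant inner product on $\mathfrak k$. Let $\mathfrak p$ be the $Q$-orthogonal complement of $\mathfrak h$ in $\mathfrak k$, identified with the tangent space $T_{eH}(K/H)$ by the differential at $e$ of the projection $K\to K/H$. Let $G\colon\mathfrak p\to\mathfrak p$ be a positive definite, $Q$-selfadjoint endomorphism which commutes with $\mathrm{Ad}_h$ for all $h\in H$, and equip $K/H$ with the $K$-invariant Riemannian metric given on $\mathfrak p\cong T_{eH}(K/H)$ by $\langle x,y\rangle=Q(Gx,y)$. Then: (a) If $x,y\in\mathfrak p$ are linearly independent eigenvectors of $G$ (possibly for different eigenvalues) with $[x,y]=0$, then $x,y$ span a plane in $T_{eH}(K/H)$ whose sectional curvature is $0$. (b) Let $x\in\mathfrak p$ be an eigenvector of $G$ for its smallest eigenvalue, let $z\in\mathfrak p$ be such that $x,z$ are linearly independent and $[x,z]=0$, and put $y=G^{-1}z$. Then $x,y$ are linearly independent, and the plane in $T_{eH}(K/H)$ which they span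 has sectional curvature $\le 0$. -/

import Mathlib

open Manifold Bundle
open scoped ContDiff

noncomputable section

/-! ## Riemannian curvature in a coordinate chart -/

section Curvature

variable {F : Type*} [NormedAddCommGroup F] [NormedSpace ℝ F]

/-- The Christoffel symbol `Γ_z(u, v)` of a metric on (an open part of) `F` with coefficients
`g z : F × F → ℝ`. It is the vector characterized by
`2 g_z(Γ_z(u, v), w) = (∂_u g)(v, w) + (∂_v g)(u, w) - (∂_w g)(u, v)` for all `w`. -/
def christoffel (g : F → F →L[ℝ] F →L[ℝ] ℝ) (z u v : F) : F :=
  (g z).inverse ((1 / 2 : ℝ) •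
    (fderiv ℝ g z u v + fderiv ℝ g z v u - ((fderiv ℝ g z).flip u).flip v))

/-- The Riemann curvature `R_z(u, v) w` of the Levi-Civita connection of a metric with
coefficients `g`, with the sign `R(X, Y) Z = ∇_X ∇_Y Z - ∇_Y ∇_X Z - ∇_[X, Y] Z`. -/
def riemannCoord (g : F → F →L[ℝ] F →L[ℝ] ℝ) (z u v w : F) : F :=
  fderiv ℝ (fun z' ↦ christoffel g z' v w) z u - fderiv ℝ (fun z' ↦ christoffel g z' u w) z v
    + christoffel g z u (christoffel g z v w) - christoffel g z v (christoffel g z u w)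

/-- The sectional curvature of the plane spanned by `u, v` at `z`, for a metric with
coefficients `g`. -/
def sectionalCoord (g : F → F →L[ℝ] F →L[ℝ] ℝ) (z u v : F) : ℝ :=
  g z (riemannCoord g z u v v) u / (g z u u * g z v v - g z u v ^ 2)

variable {M : Type*} [TopologicalSpace M] [ChartedSpace F M] [IsManifold 𝓘(ℝ, F) ∞ M]

/-- The coefficients of a Riemannian metric on `M` in the preferred chart at `p`. -/
def metricCoord
    (g : ContMDiffRiemannianMetric 𝓘(ℝ, F) ∞ F (fun m : M ↦ TangentSpace 𝓘(ℝ, F) m))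
    (p : M) (z : F) : F →L[ℝ] F →L[ℝ] ℝ :=
  let D : F →L[ℝ] F := mfderiv 𝓘(ℝ, F) 𝓘(ℝ, F) (extChartAt 𝓘(ℝ, F) p).symm z
  let b : F →L[ℝ] F →L[ℝ] ℝ := g.inner ((extChartAt 𝓘(ℝ, F) p).symm z)
  b.bilinearComp D D

/-- The sectional curvature at `p` of the plane in `T_p M` spanned by the linearly independent
tangent vectors `u, v`. -/
def sectionalCurvature
    (g : ContMDiffRiemannianMetric 𝓘(ℝ, F) ∞ F (fun m : M ↦ TangentSpace 𝓘(ℝ, F) m))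
    (p : M) (u v : TangentSpace 𝓘(ℝ, F) p) : ℝ :=
  sectionalCoord (metricCoord g p) (extChartAt 𝓘(ℝ, F) p p)
    (mfderiv 𝓘(ℝ, F) 𝓘(ℝ, F) (extChartAt 𝓘(ℝ, F) p) p u)
    (mfderiv 𝓘(ℝ, F) 𝓘(ℝ, F) (extChartAt 𝓘(ℝ, F) p) p v)

end Curvature

/-! ## Lie groups, their Lie algebras and biinvariant metrics -/

section LieGroups

variable {E : Type*} [NormedAddCommGroup E] [NormedSpace ℝ E]
  {K : Type*} [TopologicalSpace K] [ChartedSpace E K] [Group K]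

/-- The adjoint action `Ad_k` of a Lie group on its Lie algebra. -/
def lieAd (k : K) : GroupLieAlgebra 𝓘(ℝ, E) K →L[ℝ] GroupLieAlgebra 𝓘(ℝ, E) K :=
  (mfderiv 𝓘(ℝ, E) 𝓘(ℝ, E) (fun a : K ↦ k * a * k⁻¹) 1 : E →L[ℝ] E)

/-- A biinvariant metric, given on the Lie algebra: an `Ad`-invariant inner product. -/
structure IsBiinvariant (Q : LinearMap.BilinForm ℝ (GroupLieAlgebra 𝓘(ℝ, E) K)) : Prop where
  symm : ∀ x y, Q x y = Q y x
  pos : ∀ x, x ≠ 0 → 0 < Q x x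
  ad_invariant : ∀ (k : K) x y, Q (lieAd k x) (lieAd k y) = Q x y

/-- The Lie algebra of a closed subgroup `H`: all `v` with `exp (t v) ∈ H` for every `t`, where
`t ↦ exp (t v)` is the integral curve through `1` of the left-invariant vector field of `v`. -/
def subgroupLieAlgebra (H : Subgroup K) : Set (GroupLieAlgebra 𝓘(ℝ, E) K) :=
  {v | ∃ γ : ℝ → K, γ 0 = 1 ∧
    IsMIntegralCurve γ (mulInvariantVectorField v : (a : K) → TangentSpace 𝓘(ℝ, E) a) ∧
    ∀ t, γ t ∈ H}

/-- The space `𝔭`: the `Q`-orthogonal complement in the Lie algebra of `K` of that of `H`. -/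
def isotropyComplement (Q : LinearMap.BilinForm ℝ (GroupLieAlgebra 𝓘(ℝ, E) K))
    (H : Subgroup K) : Submodule ℝ (GroupLieAlgebra 𝓘(ℝ, E) K) where
  carrier := {x | ∀ v ∈ subgroupLieAlgebra H, Q x v = 0}
  add_mem' ha hb v hv := by simp [ha v hv, hb v hv]
  zero_mem' v _ := by simp
  smul_mem' c x hx v hv := by simp [hx v hv]

/-- A metric endomorphism: a positive definite selfadjoint endomorphism of `𝔭` that commutes
with `Ad_h` for all `h ∈ H`. -/
structure IsMetricEndomorphism (Q : LinearMap.BilinForm ℝ (GroupLieAlgebra 𝓘(ℝ, E) K))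
    (H : Subgroup K) (G : Module.End ℝ (isotropyComplement Q H)) : Prop where
  selfadjoint : ∀ x y : isotropyComplement Q H,
    Q (G x : GroupLieAlgebra 𝓘(ℝ, E) K) y = Q (x : GroupLieAlgebra 𝓘(ℝ, E) K) (G y)
  pos : ∀ x : isotropyComplement Q H, x ≠ 0 → 0 < Q (G x : GroupLieAlgebra 𝓘(ℝ, E) K) x
  ad_comm : ∀ h ∈ H, ∀ x y : isotropyComplement Q H,
    (y : GroupLieAlgebra 𝓘(ℝ, E) K) = lieAd (E := E) h x →
      (G y : GroupLieAlgebra 𝓘(ℝ, E) K) = lieAd (E := E) h (G x)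

end LieGroups

/-! ## Invariant metrics on the homogeneous space `K ⧸ H` -/

section HomogeneousSpaces

variable {E : Type*} [NormedAddCommGroup E] [NormedSpace ℝ E]
  {K : Type*} [TopologicalSpace K] [ChartedSpace E K] [Group K]
  {F : Type*} [NormedAddCommGroup F] [NormedSpace ℝ F]
  {H : Subgroup K} [ChartedSpace F (K ⧸ H)]

/-- The base point `eH` of `K ⧸ H`. -/
abbrev basePoint (H : Subgroup K) : K ⧸ H := QuotientGroup.mk (1 : K)

variable (E F H) in
/-- The differential at `e` of the projection `K → K ⧸ H`. Restricted to `𝔭` it is the standard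
identification of `𝔭` with the tangent space of `K ⧸ H` at `eH`. -/
def projDifferential :
    GroupLieAlgebra 𝓘(ℝ, E) K →L[ℝ] TangentSpace 𝓘(ℝ, F) (basePoint H) :=
  mfderiv 𝓘(ℝ, E) 𝓘(ℝ, F) (QuotientGroup.mk : K → K ⧸ H) 1

/-- The metric `g` on `K ⧸ H` is the `K`-invariant Riemannian metric induced by `G`: it is
`K`-invariant, and it is given by `⟨x, y⟩ = Q (G x, y)` on `𝔭 ≃ T_{eH} (K ⧸ H)`. -/
structure IsInducedMetric [IsManifold 𝓘(ℝ, F) ∞ (K ⧸ H)]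
    (Q : LinearMap.BilinForm ℝ (GroupLieAlgebra 𝓘(ℝ, E) K))
    (G : Module.End ℝ (isotropyComplement Q H))
    (g : ContMDiffRiemannianMetric 𝓘(ℝ, F) ∞ F (fun m : K ⧸ H ↦ TangentSpace 𝓘(ℝ, F) m)) :
    Prop where
  invariant : ∀ (k : K) (m : K ⧸ H) (u v : TangentSpace 𝓘(ℝ, F) m),
    g.inner (k • m) (mfderiv 𝓘(ℝ, F) 𝓘(ℝ, F) (fun m' : K ⧸ H ↦ k • m') m u)
      (mfderiv 𝓘(ℝ, F) 𝓘(ℝ, F) (fun m' : K ⧸ H ↦ k • m') m v) = g.inner m u v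
  base : ∀ x y : isotropyComplement Q H,
    g.inner (basePoint H) (projDifferential E F H x) (projDifferential E F H y) =
      Q (G x : GroupLieAlgebra 𝓘(ℝ, E) K) y

end HomogeneousSpaces

end

/-!
The curvature is computed from the Killing fields that the action of `K` induces on `K ⧸ H`, all of
it in the preferred chart at the base point, since that is how the sectional curvature is given.

Let `X` and `Y` be Killing fields with `∇_X X = 0` at a point. Differentiating Killing's equation,
and computing the second derivative of `|Y|²` along `X` in two ways, gives the numerator of their
sectional curvature as `|∇_X Y|² - |[X, Y]|² - ⟨[X, [X, Y]], Y⟩` (`curvature_killing`). Only values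
of fields and of their brackets at the point enter, and Koszul's formula (`koszul_killing`)
expresses `∇_X Y` in the same terms. The fundamental fields of the action are Killing fields and
form an anti-homomorphic image of the Lie algebra of `K` (`isKillingFamily_fundamentalField`), so
everything reduces to the bracket of the Lie algebra, `Q` and `G`.

For `x, y ∈ 𝔭` with `G x = λ x` and `[x, G y] = 0`, the `ad`-invariance of `Q` yields `∇_X X = 0`
and `⟨[X, [X, Y]], Y⟩ = 0`, so that the numerator is `|∇_X Y|² - |[x, y]|²`, where
`2 ⟨∇_X Y, n⟩ = -(Q([x, y], G n) + λ Q([x, y], n))` for `n ∈ 𝔭` (`IsInfinitesimalModel.curvature_eq`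
and `IsInfinitesimalModel.koszul`). In (a), `[x, y] = 0` forces `[x, G y] = 0`, and both terms
vanish. In (b), `z = G y`, and with `w` the `𝔭`-component of `[x, y]` the formula says that
`∇_X Y` is `-(w + λ G⁻¹ w) / 2`, whose length is at most that of `w` because `λ ≤ G`
(`least_eigenvalue_mul_le`, `IsInfinitesimalModel.curvature_nonpos`).

The only fact about `H` that is needed is that the Lie algebra of `K` is the `Q`-orthogonal sum of
`𝔭` and the kernel of the differential of the projection (`exists_isotropyComplement`). The kernel
contains the Lie algebra of `H`, and it meets `𝔭` trivially because the metric is definite on `𝔭`;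
the decomposition follows by counting dimensions.
-/

namespace HomogeneousCurvature

/-! ### Killing fields in a coordinate chart -/

section LocalMetric

set_option maxSynthPendingDepth 3

open Filter Topology VectorField

variable {F : Type*} [NormedAddCommGroup F] [NormedSpace ℝ F]

/-- The coefficients `g` define a (pseudo-)Riemannian metric of class `C^2` near `z`. The symmetry
is required on a neighbourhood, because it has to be differentiated. -/
structure IsLocalMetric (g : F → F →L[ℝ] F →L[ℝ] ℝ) (z : F) : Prop where
  contDiffAt : ContDiffAt ℝ 2 g z
  symm : ∀ᶠ z' in 𝓝 z, ∀ u v, g z' u v = g z' v u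
  invertible : (g z).IsInvertible

/-- The Christoffel symbol as a continuous bilinear map. -/
noncomputable def christoffelL (g : F → F →L[ℝ] F →L[ℝ] ℝ) (z : F) : F →L[ℝ] F →L[ℝ] F :=
  ContinuousLinearMap.compL ℝ F (F →L[ℝ] ℝ) F (g z).inverse ∘L ((1 / 2 : ℝ) •
    (fderiv ℝ g z + (fderiv ℝ g z).flip -
      ((ContinuousLinearMap.flipₗᵢ ℝ F F ℝ).toContinuousLinearEquiv :
          (F →L[ℝ] F →L[ℝ] ℝ) →L[ℝ] F →L[ℝ] F →L[ℝ] ℝ) ∘L (fderiv ℝ g z).flip))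

variable {g : F → F →L[ℝ] F →L[ℝ] ℝ} {z : F}

lemma christoffelL_apply (u v : F) : christoffelL g z u v = christoffel g z u v := rfl

lemma IsLocalMetric.differentiableAt (hg : IsLocalMetric g z) : DifferentiableAt ℝ g z :=
  hg.contDiffAt.differentiableAt (by norm_num)

lemma IsLocalMetric.eventually [CompleteSpace F] (hg : IsLocalMetric g z) :
    ∀ᶠ z' in 𝓝 z, IsLocalMetric g z' := by
  have hinv : ∀ᶠ z' in 𝓝 z, (g z').IsInvertible := by
    obtain ⟨e, he⟩ := hg.invertible
    have := e.nhds
    rw [he] at this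
    exact hg.differentiableAt.continuousAt this
  filter_upwards [hg.contDiffAt.eventually (by simp), hg.symm.eventually_nhds, hinv]
    with z' h1 h2 h3 using ⟨h1, h2, h3⟩

lemma IsLocalMetric.christoffel_spec (hg : IsLocalMetric g z) (u v w : F) :
    2 * g z (christoffel g z u v) w =
      fderiv ℝ g z u v w + fderiv ℝ g z v u w - fderiv ℝ g z w u v := by
  have h : g z ((g z).inverse ((1 / 2 : ℝ) •
      (fderiv ℝ g z u v + fderiv ℝ g z v u - ((fderiv ℝ g z).flip u).flip v))) =
      ((1 / 2 : ℝ) •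
      (fderiv ℝ g z u v + fderiv ℝ g z v u - ((fderiv ℝ g z).flip u).flip v)) := by
    obtain ⟨e, he⟩ := hg.invertible
    rw [← he]
    simp
  rw [christoffel, h]
  simp

lemma fderiv_metric_symm (hg : IsLocalMetric g z) (w u v : F) :
    fderiv ℝ g z w u v = fderiv ℝ g z w v u := by
  have h (u v : F) : fderiv ℝ (fun z' ↦ g z' u v) z w = fderiv ℝ g z w u v := by
    have := (hg.differentiableAt.hasFDerivAt.clm_apply
      (hasFDerivAt_const u z)).clm_apply (hasFDerivAt_const v z)
    rw [this.fderiv]; simp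
  rw [← h, ← h]
  congr 1
  exact EventuallyEq.fderiv_eq (hg.symm.mono fun z' h ↦ h u v)

lemma christoffel_symm (hg : IsLocalMetric g z) (u v : F) :
    christoffel g z u v = christoffel g z v u := by
  have hinj : Function.Injective (g z) := by
    obtain ⟨e, he⟩ := hg.invertible
    rw [← he]; exact e.injective
  apply hinj
  ext w
  have h1 := hg.christoffel_spec u v w
  have h2 := hg.christoffel_spec v u w
  have h3 := fderiv_metric_symm hg w u v
  linarith

/-- The Levi-Civita connection preserves the metric. -/
lemma fderiv_metric (hg : IsLocalMetric g z) (w u v : F) :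
    fderiv ℝ g z w u v = g z (christoffel g z w u) v + g z u (christoffel g z w v) := by
  have h1 := hg.christoffel_spec w u v
  have h2 := hg.christoffel_spec w v u
  have h3 := fderiv_metric_symm hg w u v
  have h4 := fderiv_metric_symm hg v w u
  have h5 := fderiv_metric_symm hg u w v
  rw [hg.symm.self_of_nhds u]
  linarith

lemma contDiffAt_christoffelL [CompleteSpace F] (hg : IsLocalMetric g z) :
    ContDiffAt ℝ 1 (christoffelL g) z := by
  have h1 : ContDiffAt ℝ 1 (fun z' ↦ (g z').inverse) z :=
    (hg.invertible.contDiffAt_map_inverse (n := 1)).comp z (hg.contDiffAt.of_le (by norm_num))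
  have h2 : ContDiffAt ℝ 1 (fderiv ℝ g) z := hg.contDiffAt.fderiv_right (by norm_num)
  have h3 : ContDiffAt ℝ 1 (fun z' ↦ (fderiv ℝ g z').flip) z :=
    (ContinuousLinearMap.flipₗᵢ ℝ F F (F →L[ℝ] ℝ)).contDiff.contDiffAt.comp z h2
  unfold christoffelL
  refine ContDiffAt.clm_comp ?_ ?_
  · exact (ContinuousLinearMap.compL ℝ F (F →L[ℝ] ℝ) F).contDiff.contDiffAt.comp z h1
  · exact ContDiffAt.const_smul (1 / 2 : ℝ) ((h2.add h3).sub (contDiffAt_const.clm_comp h3))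

/-- The covariant derivative `∇_u W` at `z` for the Levi-Civita connection of `g`. -/
noncomputable def cov (g : F → F →L[ℝ] F →L[ℝ] ℝ) (W : F → F) (z u : F) : F :=
  fderiv ℝ W z u + christoffel g z u (W z)

lemma cov_const (w u : F) : cov g (fun _ ↦ w) z u = christoffel g z u w := by
  simp [cov]

lemma cov_sub_cov (hg : IsLocalMetric g z) (X Y : F → F) :
    cov g Y z (X z) - cov g X z (Y z) = lieBracket ℝ X Y z := by
  rw [cov, cov, lieBracket, christoffel_symm hg (X z)]
  abel

lemma differentiableAt_metric_apply (hg : IsLocalMetric g z) {A B : F → F}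
    (hA : DifferentiableAt ℝ A z) (hB : DifferentiableAt ℝ B z) :
    DifferentiableAt ℝ (fun z' ↦ g z' (A z') (B z')) z ∧
    ∀ w, fderiv ℝ (fun z' ↦ g z' (A z') (B z')) z w =
      fderiv ℝ g z w (A z) (B z) + g z (fderiv ℝ A z w) (B z) + g z (A z) (fderiv ℝ B z w) := by
  have := (hg.differentiableAt.hasFDerivAt.clm_apply hA.hasFDerivAt).clm_apply hB.hasFDerivAt
  refine ⟨this.differentiableAt, fun w ↦ ?_⟩
  rw [this.fderiv]
  simp
  ring

lemma fderiv_metric_apply (hg : IsLocalMetric g z) {A B : F → F}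
    (hA : DifferentiableAt ℝ A z) (hB : DifferentiableAt ℝ B z) (w : F) :
    fderiv ℝ (fun z' ↦ g z' (A z') (B z')) z w =
      g z (cov g A z w) (B z) + g z (A z) (cov g B z w) := by
  rw [(differentiableAt_metric_apply hg hA hB).2, fderiv_metric hg, cov, cov]
  simp
  ring

/-- The vector field `X` satisfies Killing's equation `L_X g = 0` at `z`. -/
def IsKillingAt (g : F → F →L[ℝ] F →L[ℝ] ℝ) (X : F → F) (z : F) : Prop :=
  ∀ u v, fderiv ℝ g z (X z) u v + g z (fderiv ℝ X z u) v + g z u (fderiv ℝ X z v) = 0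

lemma IsKillingAt.cov_skew (hg : IsLocalMetric g z) {X : F → F} (hX : IsKillingAt g X z)
    (u v : F) : g z (cov g X z u) v + g z u (cov g X z v) = 0 := by
  have h := hX u v
  rw [fderiv_metric hg, christoffel_symm hg _ u, christoffel_symm hg _ v] at h
  simp only [cov, map_add, add_apply]
  linarith

/-- A Killing field differentiates the metric by Lie brackets. -/
lemma IsKillingAt.fderiv_apply (hg : IsLocalMetric g z) {X A B : F → F} (hX : IsKillingAt g X z)
    (hA : DifferentiableAt ℝ A z) (hB : DifferentiableAt ℝ B z) :
    fderiv ℝ (fun z' ↦ g z' (A z') (B z')) z (X z) =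
      g z (lieBracket ℝ X A z) (B z) + g z (A z) (lieBracket ℝ X B z) := by
  rw [(differentiableAt_metric_apply hg hA hB).2]
  have := hX (A z) (B z)
  simp only [lieBracket, map_sub, sub_apply]
  linarith

/-- Koszul's formula for three Killing fields. -/
lemma koszul_killing (hg : IsLocalMetric g z) {X Y Z : F → F}
    (hX : IsKillingAt g X z) (hY : IsKillingAt g Y z) (hZ : IsKillingAt g Z z)
    (dX : DifferentiableAt ℝ X z) (dY : DifferentiableAt ℝ Y z) :
    2 * g z (cov g Y z (X z)) (Z z) =
      g z (lieBracket ℝ X Y z) (Z z) - g z (lieBracket ℝ Z X z) (Y z)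
        - g z (X z) (lieBracket ℝ Z Y z) := by
  have h1 := hY.cov_skew hg (X z) (Z z)
  have h2 := hX.cov_skew hg (Y z) (Z z)
  have h3 := hZ.fderiv_apply hg dX dY
  rw [fderiv_metric_apply hg dX dY] at h3
  rw [← cov_sub_cov hg, map_sub, sub_apply]
  have h4 := hg.symm.self_of_nhds (Y z) (cov g X z (Z z))
  linarith

lemma hasFDerivAt_cov [CompleteSpace F] (hg : IsLocalMetric g z) {W : F → F}
    (hW : ContDiffAt ℝ 2 W z) (v : F) :
    HasFDerivAt (fun z' ↦ cov g W z' v)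
      ((fderiv ℝ (fderiv ℝ W) z).flip v +
        ((christoffelL g z v) ∘L (fderiv ℝ W z) +
          ((fderiv ℝ (christoffelL g) z).flip v).flip (W z))) z := by
  have hW1 : DifferentiableAt ℝ W z := hW.differentiableAt (by norm_num)
  have hW2 : DifferentiableAt ℝ (fderiv ℝ W) z :=
    (hW.fderiv_right (m := 1) (by norm_num)).differentiableAt (by norm_num)
  have hΓ : DifferentiableAt ℝ (christoffelL g) z :=
    (contDiffAt_christoffelL hg).differentiableAt (by norm_num)
  have h1 := hW2.hasFDerivAt.clm_apply (hasFDerivAt_const v z)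
  have h2 := (hΓ.hasFDerivAt.clm_apply (hasFDerivAt_const v z)).clm_apply hW1.hasFDerivAt
  refine (h1.add h2).congr_fderiv ?_
  simp

/-- The Ricci identity, for coordinate directions `u` and `v`: the curvature is the commutator of
second covariant derivatives. -/
lemma riemannCoord_eq_cov [CompleteSpace F] (hg : IsLocalMetric g z) {W : F → F}
    (hW : ContDiffAt ℝ 2 W z) (u v : F) :
    riemannCoord g z u v (W z) =
      cov g (fun z' ↦ cov g W z' v) z u - cov g (fun z' ↦ cov g W z' u) z v := by
  have hΓ : DifferentiableAt ℝ (christoffelL g) z :=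
    (contDiffAt_christoffelL hg).differentiableAt (by norm_num)
  have hd (a w b : F) : fderiv ℝ (fun z' ↦ christoffel g z' a w) z b =
      fderiv ℝ (christoffelL g) z b a w := by
    have := (hΓ.hasFDerivAt.clm_apply (hasFDerivAt_const a z)).clm_apply (hasFDerivAt_const w z)
    have h' : HasFDerivAt (fun z' ↦ christoffel g z' a w) _ z := this
    rw [h'.fderiv]
    simp
  have hs : fderiv ℝ (fderiv ℝ W) z u v = fderiv ℝ (fderiv ℝ W) z v u :=
    (hW.isSymmSndFDerivAt (by simp)) u v
  change _ = (fderiv ℝ (fun z' ↦ cov g W z' v) z u + christoffel g z u (cov g W z v)) -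
    (fderiv ℝ (fun z' ↦ cov g W z' u) z v + christoffel g z v (cov g W z u))
  rw [riemannCoord, hd, hd, (hasFDerivAt_cov hg hW v).fderiv,
    (hasFDerivAt_cov hg hW u).fderiv]
  simp only [cov, add_apply, ContinuousLinearMap.flip_apply,
    ContinuousLinearMap.comp_apply, ← christoffelL_apply, map_add, hs]
  abel

/-- For Killing fields `X` and `Y` with `∇_X X = 0` at `z`, the numerator of the sectional curvature
of `X` and `Y` is `|∇_X Y|² - |[X, Y]|² - ⟨[X, [X, Y]], Y⟩`. -/
lemma curvature_killing [CompleteSpace F] (hg : IsLocalMetric g z) {X Y : F → F}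
    (hX : ∀ᶠ z' in 𝓝 z, IsKillingAt g X z') (hY : ∀ᶠ z' in 𝓝 z, IsKillingAt g Y z')
    (dX : ContDiffAt ℝ 2 X z) (dY : ContDiffAt ℝ 2 Y z)
    (hXX : cov g X z (X z) = 0) :
    g z (riemannCoord g z (X z) (Y z) (Y z)) (X z) =
      g z (cov g Y z (X z)) (cov g Y z (X z))
        - g z (lieBracket ℝ X Y z) (lieBracket ℝ X Y z)
        - g z (lieBracket ℝ X (lieBracket ℝ X Y) z) (Y z) := by
  set u := X z with hu
  set v := Y z with hv
  have hg' := hg.eventually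
  have dY' : ∀ᶠ z' in 𝓝 z, DifferentiableAt ℝ Y z' :=
    (dY.eventually (by simp)).mono fun z' h ↦ h.differentiableAt (by norm_num)
  have dX' : ∀ᶠ z' in 𝓝 z, DifferentiableAt ℝ X z' :=
    (dX.eventually (by simp)).mono fun z' h ↦ h.differentiableAt (by norm_num)
  have dS := (hasFDerivAt_cov hg dY u).differentiableAt
  have dT := (hasFDerivAt_cov hg dY v).differentiableAt
  have dY0 := dY'.self_of_nhds
  have dX0 := dX'.self_of_nhds
  have symm := hg.symm.self_of_nhds
  -- `⟨∇_u Y, u⟩ = 0`, differentiated in the direction `v`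
  have h1 : g z (cov g (fun z' ↦ cov g Y z' u) z v) u
      + g z (cov g Y z u) (christoffel g z v u) = 0 := by
    have := fderiv_metric_apply hg dS (differentiableAt_const u) v
    rw [cov_const] at this
    rw [← this]
    have h0 : (fun z' ↦ g z' (cov g Y z' u) u) =ᶠ[𝓝 z] fun _ ↦ 0 := by
      filter_upwards [hg', hY] with z' h1 h2
      have := h2.cov_skew h1 u u
      rw [h1.symm.self_of_nhds u] at this
      linarith
    rw [h0.fderiv_eq]; simp
  -- `⟨∇_v Y, u⟩ + ⟨∇_u Y, v⟩ = 0`, differentiated in the direction `u`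
  have h2 : g z (cov g (fun z' ↦ cov g Y z' v) z u) u + g z (cov g Y z v) (christoffel g z u u)
      + (g z (cov g (fun z' ↦ cov g Y z' u) z u) v
        + g z (cov g Y z u) (christoffel g z u v)) = 0 := by
    have e1 := fderiv_metric_apply hg dT (differentiableAt_const u) u
    have e2 := fderiv_metric_apply hg dS (differentiableAt_const v) u
    rw [cov_const] at e1 e2
    rw [← e1, ← e2, ← add_apply, ← fderiv_fun_add
      (differentiableAt_metric_apply hg dT (differentiableAt_const u)).1
      (differentiableAt_metric_apply hg dS (differentiableAt_const v)).1]
    have h0 : (fun z' ↦ g z' (cov g Y z' v) u + g z' (cov g Y z' u) v) =ᶠ[𝓝 z] fun _ ↦ 0 := by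
      filter_upwards [hg', hY] with z' h1 h2
      have := h2.cov_skew h1 v u
      rw [h1.symm.self_of_nhds v] at this
      linarith
    rw [h0.fderiv_eq]; simp
  -- the second derivative of `f = ⟨Y, Y⟩` in the direction of `X`, in two ways
  set f : F → ℝ := fun z' ↦ g z' (Y z') (Y z') with hf
  have df : ContDiffAt ℝ 2 f z := (hg.contDiffAt.clm_apply dY).clm_apply dY
  have df1 : DifferentiableAt ℝ (fderiv ℝ f) z :=
    (df.fderiv_right (m := 1) (by norm_num)).differentiableAt (by norm_num)
  have h3 : fderiv ℝ (fderiv ℝ f) z u u =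
      2 * (g z (cov g (fun z' ↦ cov g Y z' u) z u) v + g z (cov g Y z u) (cov g Y z u)) := by
    have e0 : fderiv ℝ (fun z' ↦ fderiv ℝ f z' u) z u = fderiv ℝ (fderiv ℝ f) z u u := by
      rw [(df1.hasFDerivAt.clm_apply (hasFDerivAt_const u z)).fderiv]; simp
    have e1 : (fun z' ↦ fderiv ℝ f z' u) =ᶠ[𝓝 z] fun z' ↦ 2 * g z' (cov g Y z' u) (Y z') := by
      filter_upwards [hg', dY'] with z' h1 h2
      rw [hf, fderiv_metric_apply h1 h2 h2, h1.symm.self_of_nhds (Y z')]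
      ring
    rw [← e0, e1.fderiv_eq, fderiv_const_mul (differentiableAt_metric_apply hg dS dY0).1,
      smul_apply, fderiv_metric_apply hg dS dY0, smul_eq_mul]
  have h4 : fderiv ℝ (fun z' ↦ fderiv ℝ f z' (X z')) z u =
      fderiv ℝ (fderiv ℝ f) z u u + fderiv ℝ f z (fderiv ℝ X z u) := by
    rw [(df1.hasFDerivAt.clm_apply dX0.hasFDerivAt).fderiv]
    simp [← hu, add_comm]
  have dL : DifferentiableAt ℝ (lieBracket ℝ X Y) z := by
    have e1 : DifferentiableAt ℝ (fderiv ℝ X) z :=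
      (dX.fderiv_right (m := 1) (by norm_num)).differentiableAt (by norm_num)
    have e2 : DifferentiableAt ℝ (fderiv ℝ Y) z :=
      (dY.fderiv_right (m := 1) (by norm_num)).differentiableAt (by norm_num)
    exact (e2.clm_apply dX0).sub (e1.clm_apply dY0)
  have h5 : fderiv ℝ (fun z' ↦ fderiv ℝ f z' (X z')) z u =
      2 * (g z (lieBracket ℝ X (lieBracket ℝ X Y) z) v
        + g z (lieBracket ℝ X Y z) (lieBracket ℝ X Y z)) := by
    have e1 : (fun z' ↦ fderiv ℝ f z' (X z')) =ᶠ[𝓝 z]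
        fun z' ↦ 2 * g z' (lieBracket ℝ X Y z') (Y z') := by
      filter_upwards [hg', hX, dY'] with z' h1 h2 h3
      rw [hf, h2.fderiv_apply h1 h3 h3, h1.symm.self_of_nhds (Y z')]
      ring
    rw [e1.fderiv_eq, fderiv_const_mul (differentiableAt_metric_apply hg dL dY0).1,
      smul_apply, hu, hX.self_of_nhds.fderiv_apply hg dL dY0, smul_eq_mul]
  have h6 : fderiv ℝ f z (fderiv ℝ X z u) = 2 * g z (cov g Y z v) (christoffel g z u u) := by
    have e : fderiv ℝ X z u = - christoffel g z u u := by
      rw [cov] at hXX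
      exact eq_neg_of_add_eq_zero_left hXX
    rw [hf, fderiv_metric_apply hg dY0 dY0, e, symm (Y z)]
    have h7 := hY.self_of_nhds.cov_skew hg v (- christoffel g z u u)
    rw [symm v] at h7
    rw [map_neg] at h7
    linarith
  have h7 := christoffel_symm hg v u
  rw [h7] at h1
  have hR : riemannCoord g z u v v = cov g (fun z' ↦ cov g Y z' v) z u -
      cov g (fun z' ↦ cov g Y z' u) z v := riemannCoord_eq_cov hg dY u v
  rw [hR, map_sub, sub_apply]
  linarith

end LocalMetric

/-! ### Local actions and their fundamental fields -/

section LocalAction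

set_option maxSynthPendingDepth 3

open Filter Topology VectorField

variable {E F V : Type*} [NormedAddCommGroup E] [NormedSpace ℝ E]
  [NormedAddCommGroup F] [NormedSpace ℝ F] [NormedAddCommGroup V] [NormedSpace ℝ V]

lemma fderiv_partial_fst {f : E × F → V} {e : E} {z : F} (hf : DifferentiableAt ℝ f (e, z))
    (v : E) : fderiv ℝ (fun e' ↦ f (e', z)) e v = fderiv ℝ f (e, z) (v, 0) := by
  have h := hf.hasFDerivAt.comp e (f := fun e' : E ↦ (e', z))
    ((hasFDerivAt_id e).prodMk (hasFDerivAt_const z e))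
  have h' : HasFDerivAt (fun e' ↦ f (e', z)) _ e := h
  rw [h'.fderiv]
  simp

lemma fderiv_partial_snd {f : E × F → V} {e : E} {z : F} (hf : DifferentiableAt ℝ f (e, z))
    (u : F) : fderiv ℝ (fun z' ↦ f (e, z')) z u = fderiv ℝ f (e, z) (0, u) := by
  have h := hf.hasFDerivAt.comp z (f := fun z' : F ↦ (e, z'))
    ((hasFDerivAt_const e z).prodMk (hasFDerivAt_id z))
  have h' : HasFDerivAt (fun z' ↦ f (e, z')) _ z := h
  rw [h'.fderiv]
  simp

lemma eventually_differentiableAt {f : E → V} {x : E} {n : ℕ} (hn : n ≠ 0)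
    (hf : ContDiffAt ℝ n f x) : ∀ᶠ y in 𝓝 x, DifferentiableAt ℝ f y :=
  (hf.eventually (by simp)).mono fun _ h ↦ h.differentiableAt (by exact_mod_cast hn)

lemma hasFDerivAt_fderiv {f : E → V} {x : E} (hf : ContDiffAt ℝ 2 f x) :
    HasFDerivAt (fderiv ℝ f) (fderiv ℝ (fderiv ℝ f) x) x :=
  ((hf.fderiv_right (m := 1) (by norm_num)).differentiableAt (by norm_num)).hasFDerivAt

/-- Derivative in the second variable of a partial derivative in the first variable. -/
lemma fderiv_partial_fst_snd {f : E × F → V} {e : E} {z : F}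
    (hf : ContDiffAt ℝ 2 f (e, z)) (v : E) :
    DifferentiableAt ℝ (fun z' ↦ fderiv ℝ (fun e' ↦ f (e', z')) e v) z ∧
    ∀ u, fderiv ℝ (fun z' ↦ fderiv ℝ (fun e' ↦ f (e', z')) e v) z u =
      fderiv ℝ (fderiv ℝ f) (e, z) (0, u) (v, 0) := by
  have hev : (fun z' ↦ fderiv ℝ (fun e' ↦ f (e', z')) e v) =ᶠ[𝓝 z]
      fun z' ↦ fderiv ℝ f (e, z') (v, 0) := by
    have : Tendsto (fun z' : F ↦ (e, z')) (𝓝 z) (𝓝 (e, z)) :=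
      (continuous_const.prodMk continuous_id).tendsto z
    filter_upwards [this.eventually (eventually_differentiableAt two_ne_zero hf)] with z' h
    exact fderiv_partial_fst h v
  have h1 := (hasFDerivAt_fderiv hf).comp z (f := fun z' : F ↦ (e, z'))
    ((hasFDerivAt_const e z).prodMk (hasFDerivAt_id z))
  have h2 : HasFDerivAt (fun z' ↦ fderiv ℝ f (e, z') (v, 0)) _ z :=
    h1.clm_apply (hasFDerivAt_const (v, (0 : F)) z)
  have h3 := h2.congr_of_eventuallyEq hev
  refine ⟨h3.differentiableAt, fun u ↦ ?_⟩
  rw [h3.fderiv]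
  simp

/-- Derivative in the first variable of a partial derivative in the second variable. -/
lemma fderiv_partial_snd_fst {f : E × F → V} {e : E} {z : F}
    (hf : ContDiffAt ℝ 2 f (e, z)) (u : F) :
    DifferentiableAt ℝ (fun e' ↦ fderiv ℝ (fun z' ↦ f (e', z')) z u) e ∧
    ∀ v, fderiv ℝ (fun e' ↦ fderiv ℝ (fun z' ↦ f (e', z')) z u) e v =
      fderiv ℝ (fderiv ℝ f) (e, z) (v, 0) (0, u) := by
  have hev : (fun e' ↦ fderiv ℝ (fun z' ↦ f (e', z')) z u) =ᶠ[𝓝 e]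
      fun e' ↦ fderiv ℝ f (e', z) (0, u) := by
    have : Tendsto (fun e' : E ↦ (e', z)) (𝓝 e) (𝓝 (e, z)) :=
      (continuous_id.prodMk continuous_const).tendsto e
    filter_upwards [this.eventually (eventually_differentiableAt two_ne_zero hf)] with e' h
    exact fderiv_partial_snd h u
  have h1 := (hasFDerivAt_fderiv hf).comp e (f := fun e' : E ↦ (e', z))
    ((hasFDerivAt_id e).prodMk (hasFDerivAt_const z e))
  have h2 : HasFDerivAt (fun e' ↦ fderiv ℝ f (e', z) (0, u)) _ e :=
    h1.clm_apply (hasFDerivAt_const ((0 : E), u) e)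
  have h3 := h2.congr_of_eventuallyEq hev
  refine ⟨h3.differentiableAt, fun v ↦ ?_⟩
  rw [h3.fderiv]
  simp

/-- The vector field on `F` generated by `v` under the local action `a` whose neutral element is
`e₀`. -/
noncomputable def fundamentalField (a : E × F → F) (e₀ v : E) (z : F) : F :=
  fderiv ℝ (fun e ↦ a (e, z)) e₀ v

/-- The left-invariant vector field of `v` for the local multiplication `μ` whose neutral element
is `e₀`. -/
noncomputable def leftField (μ : E × E → E) (e₀ v e : E) : E :=
  fderiv ℝ (fun e' ↦ μ (e, e')) e₀ v

variable {a : E × F → F} {μ c : E × E → E} {e₀ : E} {z : F}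

lemma contDiffAt_fundamentalField (ha : ContDiffAt ℝ 3 a (e₀, z)) (v : E) :
    ContDiffAt ℝ 2 (fundamentalField a e₀ v) z := by
  have hev : fundamentalField a e₀ v =ᶠ[𝓝 z] fun z' ↦ fderiv ℝ a (e₀, z') (v, 0) := by
    have : Tendsto (fun z' : F ↦ (e₀, z')) (𝓝 z) (𝓝 (e₀, z)) :=
      (continuous_const.prodMk continuous_id).tendsto z
    filter_upwards [this.eventually (eventually_differentiableAt three_ne_zero ha)] with z' h
    exact fderiv_partial_fst h v
  refine ContDiffAt.congr_of_eventuallyEq ?_ hev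
  have h1 : ContDiffAt ℝ 2 (fderiv ℝ a) (e₀, z) := ha.fderiv_right (by norm_num)
  have h2 : ContDiffAt ℝ 2 (fun z' ↦ fderiv ℝ a (e₀, z')) z :=
    h1.comp z (contDiffAt_const.prodMk contDiffAt_id)
  exact h2.clm_apply contDiffAt_const

/-- The derivative at the neutral element of `a (μ (e, e'), z) = a (e, a (e', z))`, in `e'` along
`w` and then in `e` along `v`. -/
lemma fderiv_fundamentalField (ha : ContDiffAt ℝ 2 a (e₀, z)) (hμ : ContDiffAt ℝ 2 μ (e₀, e₀))
    (hμ1 : ∀ᶠ e in 𝓝 e₀, μ (e, e₀) = e) (hμ2 : ∀ᶠ e in 𝓝 e₀, μ (e₀, e) = e)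
    (ha1 : a (e₀, z) = z)
    (hact : ∀ᶠ p in 𝓝 ((e₀, e₀), z), a (μ p.1, p.2) = a (p.1.1, a (p.1.2, p.2))) (v w : E) :
    fderiv ℝ (fundamentalField a e₀ v) z (fundamentalField a e₀ w z) =
      fderiv ℝ (fderiv ℝ a) (e₀, z) (v, 0) (w, 0) +
        fundamentalField a e₀ (fderiv ℝ (leftField μ e₀ w) e₀ v) z := by
  have hμ0 : μ (e₀, e₀) = e₀ := hμ1.self_of_nhds
  have ta : Tendsto (fun e : E ↦ (e, z)) (𝓝 e₀) (𝓝 (e₀, z)) :=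
    (continuous_id.prodMk continuous_const).tendsto e₀
  have tμ : Tendsto (fun e : E ↦ (e, e₀)) (𝓝 e₀) (𝓝 (e₀, e₀)) :=
    (continuous_id.prodMk continuous_const).tendsto e₀
  have tact : Tendsto (fun e : E ↦ ((e, e₀), z)) (𝓝 e₀) (𝓝 ((e₀, e₀), z)) :=
    ((continuous_id.prodMk continuous_const).prodMk continuous_const).tendsto e₀
  have da := eventually_differentiableAt two_ne_zero ha
  have dμ := eventually_differentiableAt two_ne_zero hμ
  have hev : (fun e ↦ fderiv ℝ a (e, z) (leftField μ e₀ w e, 0)) =ᶠ[𝓝 e₀]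
      fun e ↦ fderiv ℝ (fun z' ↦ a (e, z')) z (fundamentalField a e₀ w z) := by
    filter_upwards [ta.eventually da, tμ.eventually dμ, hμ1, tact.eventually hact.eventually_nhds]
      with e h1 h2 h3 h4
    have t4 : Tendsto (fun e' : E ↦ ((e, e'), z)) (𝓝 e₀) (𝓝 ((e, e₀), z)) :=
      ((continuous_const.prodMk continuous_id).prodMk continuous_const).tendsto e₀
    have h5 : (fun e' ↦ a (μ (e, e'), z)) =ᶠ[𝓝 e₀] fun e' ↦ a (e, a (e', z)) := t4.eventually h4
    have h6 := h5.fderiv_eq (𝕜 := ℝ)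
    have d2 : DifferentiableAt ℝ (fun e' ↦ μ (e, e')) e₀ :=
      DifferentiableAt.comp e₀ h2 ((differentiableAt_const e).prodMk differentiableAt_id)
    have d1 : DifferentiableAt ℝ (fun e' ↦ a (e', z)) (μ (e, e₀)) := by
      rw [h3]; exact h1.comp e (differentiableAt_id.prodMk (differentiableAt_const z))
    have d3 : DifferentiableAt ℝ (fun z' ↦ a (e, z')) (a (e₀, z)) := by
      rw [ha1]; exact h1.comp z ((differentiableAt_const e).prodMk differentiableAt_id)
    have d4 : DifferentiableAt ℝ (fun e' ↦ a (e', z)) e₀ :=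
      da.self_of_nhds.comp e₀ (differentiableAt_id.prodMk (differentiableAt_const z))
    have l := fderiv_comp e₀ d1 d2
    have r := fderiv_comp e₀ d3 d4
    simp only [Function.comp_def] at l r
    rw [l, r, h3, ha1] at h6
    rw [← fderiv_partial_fst h1]
    exact congrArg (fun T : E →L[ℝ] F ↦ T w) h6
  have hL : DifferentiableAt ℝ (leftField μ e₀ w) e₀ := (fderiv_partial_snd_fst hμ w).1
  have hL0 : leftField μ e₀ w e₀ = w := by
    rw [leftField, EventuallyEq.fderiv_eq (f := id) hμ2]; simp
  have h1 := (hasFDerivAt_fderiv ha).comp e₀ (f := fun e : E ↦ (e, z))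
    ((hasFDerivAt_id e₀).prodMk (hasFDerivAt_const z e₀))
  have h2 : HasFDerivAt (fun e ↦ fderiv ℝ a (e, z) (leftField μ e₀ w e, 0)) _ e₀ :=
    h1.clm_apply (hL.hasFDerivAt.prodMk (hasFDerivAt_const (0 : F) e₀))
  have h3 := congrArg (fun T : E →L[ℝ] F ↦ T v) hev.fderiv_eq
  beta_reduce at h3
  rw [h2.fderiv, (fderiv_partial_snd_fst ha _).2] at h3
  have hX : fderiv ℝ (fundamentalField a e₀ v) z (fundamentalField a e₀ w z) = _ :=
    (fderiv_partial_fst_snd ha v).2 _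
  rw [hX, (ha.isSymmSndFDerivAt (by simp)) _ _, ← h3]
  simp [hL0, fundamentalField, fderiv_partial_fst da.self_of_nhds, add_comm]

/-- The fundamental fields of a left action form an anti-homomorphic image of the Lie algebra of
left-invariant fields. -/
lemma lieBracket_fundamentalField (ha : ContDiffAt ℝ 2 a (e₀, z))
    (hμ : ContDiffAt ℝ 2 μ (e₀, e₀))
    (hμ1 : ∀ᶠ e in 𝓝 e₀, μ (e, e₀) = e) (hμ2 : ∀ᶠ e in 𝓝 e₀, μ (e₀, e) = e)
    (ha1 : a (e₀, z) = z)
    (hact : ∀ᶠ p in 𝓝 ((e₀, e₀), z), a (μ p.1, p.2) = a (p.1.1, a (p.1.2, p.2))) (v w : E) :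
    lieBracket ℝ (fundamentalField a e₀ v) (fundamentalField a e₀ w) z =
      - fundamentalField a e₀ (lieBracket ℝ (leftField μ e₀ v) (leftField μ e₀ w) e₀) z := by
  have hL (w : E) : leftField μ e₀ w e₀ = w := by
    rw [leftField, EventuallyEq.fderiv_eq (f := id) hμ2]; simp
  rw [lieBracket, lieBracket, fderiv_fundamentalField ha hμ hμ1 hμ2 ha1 hact,
    fderiv_fundamentalField ha hμ hμ1 hμ2 ha1 hact, hL, hL,
    (ha.isSymmSndFDerivAt (by simp)) (w, 0) (v, 0)]
  simp only [fundamentalField, map_sub]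
  abel

/-- If the local action preserves the metric, its fundamental fields satisfy Killing's equation. -/
lemma isKillingAt_fundamentalField {m : F → F →L[ℝ] F →L[ℝ] ℝ} (hm : DifferentiableAt ℝ m z)
    (ha : ContDiffAt ℝ 2 a (e₀, z)) (ha1 : ∀ᶠ z' in 𝓝 z, a (e₀, z') = z')
    (hinv : ∀ᶠ e in 𝓝 e₀, ∀ u v, m (a (e, z)) (fderiv ℝ (fun z' ↦ a (e, z')) z u)
      (fderiv ℝ (fun z' ↦ a (e, z')) z v) = m z u v) (w : E) :
    IsKillingAt m (fundamentalField a e₀ w) z := by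
  intro u v
  have hid (u : F) : fderiv ℝ (fun z' ↦ a (e₀, z')) z u = u := by
    rw [EventuallyEq.fderiv_eq (f := id) ha1]; simp
  have d1 : HasFDerivAt (fun e' ↦ a (e', z)) _ e₀ :=
    ((ha.differentiableAt (by norm_num)).comp e₀
      (differentiableAt_id.prodMk (differentiableAt_const z))).hasFDerivAt
  have hm' : HasFDerivAt m (fderiv ℝ m z) (a (e₀, z)) := by
    rw [ha1.self_of_nhds]; exact hm.hasFDerivAt
  have d2 := hm'.comp e₀ d1
  have hev : (fun e ↦ m (a (e, z)) (fderiv ℝ (fun z' ↦ a (e, z')) z u)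
      (fderiv ℝ (fun z' ↦ a (e, z')) z v)) =ᶠ[𝓝 e₀] fun _ ↦ m z u v := hinv.mono fun e h ↦ h u v
  have du := fderiv_partial_snd_fst ha u
  have dv := fderiv_partial_snd_fst ha v
  have h : HasFDerivAt (fun e ↦ m (a (e, z)) (fderiv ℝ (fun z' ↦ a (e, z')) z u)
      (fderiv ℝ (fun z' ↦ a (e, z')) z v)) _ e₀ :=
    (d2.clm_apply du.1.hasFDerivAt).clm_apply dv.1.hasFDerivAt
  have h1 := congrArg (fun T : E →L[ℝ] ℝ ↦ T w) (h.fderiv.symm.trans hev.fderiv_eq)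
  have eu : fderiv ℝ (fundamentalField a e₀ w) z u = _ :=
    (fderiv_partial_fst_snd ha w).2 u
  have ev : fderiv ℝ (fundamentalField a e₀ w) z v = _ :=
    (fderiv_partial_fst_snd ha w).2 v
  rw [eu, ev, (ha.isSymmSndFDerivAt (by simp)) (0, u), (ha.isSymmSndFDerivAt (by simp)) (0, v),
    ← du.2, ← dv.2]
  simp [hid, ha1.self_of_nhds, Function.comp_def] at h1
  simp only [fundamentalField]
  linarith

/-- The derivative at the neutral element of the adjoint action is the Lie bracket. Here `c` is
conjugation, characterized by `c (e, e') * e = e * e'`. -/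
lemma fderiv_conj (hμ : ContDiffAt ℝ 2 μ (e₀, e₀)) (hc : ContDiffAt ℝ 2 c (e₀, e₀))
    (hμ1 : ∀ᶠ e in 𝓝 e₀, μ (e, e₀) = e) (hμ2 : ∀ᶠ e in 𝓝 e₀, μ (e₀, e) = e)
    (hc1 : ∀ᶠ e in 𝓝 e₀, c (e, e₀) = e₀) (hc2 : ∀ᶠ e in 𝓝 e₀, c (e₀, e) = e)
    (hconj : ∀ᶠ p in 𝓝 (e₀, e₀), μ (c p, p.1) = μ p) (v x : E) :
    fderiv ℝ (leftField c e₀ x) e₀ v =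
      lieBracket ℝ (leftField μ e₀ v) (leftField μ e₀ x) e₀ := by
  have dμ := eventually_differentiableAt two_ne_zero hμ
  have dc := eventually_differentiableAt two_ne_zero hc
  have hL (w : E) : leftField μ e₀ w e₀ = w := by
    rw [leftField, EventuallyEq.fderiv_eq (f := id) hμ2]; simp
  have hA (w : E) : leftField c e₀ w e₀ = w := by
    rw [leftField, EventuallyEq.fderiv_eq (f := id) hc2]; simp
  have t1 : Tendsto (fun e : E ↦ (e, e₀)) (𝓝 e₀) (𝓝 (e₀, e₀)) :=
    (continuous_id.prodMk continuous_const).tendsto e₀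
  have t2 : Tendsto (fun e : E ↦ (e₀, e)) (𝓝 e₀) (𝓝 (e₀, e₀)) :=
    (continuous_const.prodMk continuous_id).tendsto e₀
  have hev : (fun e ↦ fderiv ℝ μ (e₀, e) (leftField c e₀ x e, 0)) =ᶠ[𝓝 e₀] leftField μ e₀ x := by
    filter_upwards [t1.eventually dμ, t2.eventually dμ, t1.eventually dc, hc1,
      t1.eventually hconj.eventually_nhds] with e h1 h2 h3 h4 h5
    have t5 : Tendsto (fun e' : E ↦ (e, e')) (𝓝 e₀) (𝓝 (e, e₀)) :=
      (continuous_const.prodMk continuous_id).tendsto e₀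
    have h6 : (fun e' ↦ μ (c (e, e'), e)) =ᶠ[𝓝 e₀] fun e' ↦ μ (e, e') := t5.eventually h5
    have d2 : DifferentiableAt ℝ (fun e' ↦ c (e, e')) e₀ :=
      h3.comp e₀ ((differentiableAt_const e).prodMk differentiableAt_id)
    have d1 : DifferentiableAt ℝ (fun e' ↦ μ (e', e)) (c (e, e₀)) := by
      rw [h4]; exact h2.comp e₀ (differentiableAt_id.prodMk (differentiableAt_const e))
    have l := fderiv_comp e₀ d1 d2
    simp only [Function.comp_def] at l
    have h7 := h6.fderiv_eq (𝕜 := ℝ)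
    rw [l, h4] at h7
    rw [← fderiv_partial_fst h2]
    exact congrArg (fun T : E →L[ℝ] E ↦ T x) h7
  have hA' : DifferentiableAt ℝ (leftField c e₀ x) e₀ := (fderiv_partial_snd_fst hc x).1
  have h1 := (hasFDerivAt_fderiv hμ).comp e₀ (f := fun e : E ↦ (e₀, e))
    ((hasFDerivAt_const e₀ e₀).prodMk (hasFDerivAt_id e₀))
  have h2 : HasFDerivAt (fun e ↦ fderiv ℝ μ (e₀, e) (leftField c e₀ x e, 0)) _ e₀ :=
    h1.clm_apply (hA'.hasFDerivAt.prodMk (hasFDerivAt_const (0 : E) e₀))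
  have h3 := congrArg (fun T : E →L[ℝ] E ↦ T v) (h2.fderiv.symm.trans hev.fderiv_eq)
  have hμid (w : E) : fderiv ℝ μ (e₀, e₀) (w, 0) = w := by
    rw [← fderiv_partial_fst dμ.self_of_nhds, EventuallyEq.fderiv_eq (f := id) hμ1]; simp
  have e1 : fderiv ℝ (leftField μ e₀ v) e₀ x = _ := (fderiv_partial_snd_fst hμ v).2 x
  rw [(hμ.isSymmSndFDerivAt (by simp)) _ _] at e1
  rw [lieBracket, hL, hL, ← h3, e1]
  simp [hA, hμid]

end LocalAction

/-! ### Curvature from infinitesimal data -/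

section Algebra

open Filter Topology VectorField

/-- The smallest eigenvalue of a selfadjoint endomorphism bounds its quadratic form from below. -/
lemma least_eigenvalue_mul_le {V : Type*} [AddCommGroup V] [Module ℝ V] [FiniteDimensional ℝ V]
    (B : LinearMap.BilinForm ℝ V) (hsymm : ∀ x y, B x y = B y x) (hpos : ∀ x, x ≠ 0 → 0 < B x x)
    (G : Module.End ℝ V) (hG : ∀ x y, B (G x) y = B x (G y)) {lam : ℝ}
    (hlam : lam ∈ lowerBounds {a : ℝ | G.HasEigenvalue a}) (u : V) :
    lam * B u u ≤ B (G u) u := by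
  let core : InnerProductSpace.Core ℝ V :=
    { inner := fun x y ↦ B x y
      conj_inner_symm := fun x y ↦ hsymm y x
      re_inner_nonneg := fun x ↦ by
        rcases eq_or_ne x 0 with rfl | h
        · simp
        · exact (hpos x h).le
      add_left := fun x y w ↦ by simp
      smul_left := fun x y r ↦ by simp
      definite := fun x h ↦ by
        by_contra hx
        exact (hpos x hx).ne' h }
  let _ : NormedAddCommGroup V := core.toNormedAddCommGroup
  let _ : InnerProductSpace ℝ V := InnerProductSpace.ofCore core.toCore
  have hT : G.IsSymmetric := hG
  let e := hT.eigenvectorBasis rfl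
  have h1 : B (G u) u = ∑ i, hT.eigenvalues rfl i * (inner ℝ u (e i) * inner ℝ (e i) u) := by
    change inner ℝ (G u) u = _
    rw [← e.sum_inner_mul_inner]
    refine Finset.sum_congr rfl fun i _ ↦ ?_
    rw [hT u (e i), hT.apply_eigenvectorBasis, inner_smul_right]
    simp [mul_assoc, e]
  have h2 : B u u = ∑ i, inner ℝ u (e i) * inner ℝ (e i) u := (e.sum_inner_mul_inner u u).symm
  rw [h1, h2, Finset.mul_sum]
  refine Finset.sum_le_sum fun i _ ↦ ?_
  refine mul_le_mul_of_nonneg_right (hlam (hT.hasEigenvalue_eigenvalues rfl i)) ?_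
  rw [real_inner_comm]
  exact mul_self_nonneg _

variable {F : Type*} [NormedAddCommGroup F] [NormedSpace ℝ F] [CompleteSpace F]
  {𝔨 : Type*} [AddCommGroup 𝔨] [Module ℝ 𝔨]

/-- `X` is a family of Killing fields of the metric `m` near `z` which is an anti-homomorphic image
of the bracket `b`, as are the fundamental fields of an isometric left action. -/
structure IsKillingFamily (m : F → F →L[ℝ] F →L[ℝ] ℝ) (z : F) (b : 𝔨 → 𝔨 → 𝔨) (X : 𝔨 → F → F) :
    Prop where
  metric : IsLocalMetric m z
  contDiffAt : ∀ v, ContDiffAt ℝ 2 (X v) z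
  killing : ∀ v, ∀ᶠ z' in 𝓝 z, IsKillingAt m (X v) z'
  bracket : ∀ v w, ∀ᶠ z' in 𝓝 z, lieBracket ℝ (X v) (X w) z' = - X (b v w) z'

/-- The infinitesimal data of an invariant metric on a homogeneous space: the metric `m` at the base
point `z` in terms of an `ad`-invariant symmetric form `Q` and an endomorphism `G` of `𝔭`, where the
values at `z` of the Killing fields from `𝔭` exhaust the tangent space. -/
structure IsInfinitesimalModel (m : F → F →L[ℝ] F →L[ℝ] ℝ) (z : F) (b : 𝔨 → 𝔨 → 𝔨)
    (X : 𝔨 → F → F) (Q : LinearMap.BilinForm ℝ 𝔨) (𝔭 : Submodule ℝ 𝔨) (G : Module.End ℝ 𝔭) :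
    Prop extends IsKillingFamily m z b X where
  pos : ∀ u, u ≠ 0 → 0 < m z u u
  swap : ∀ v w, b v w = - b w v
  symm : ∀ v w, Q v w = Q w v
  ad_invariant : ∀ v x y, Q (b v x) y + Q x (b v y) = 0
  surj : ∀ u : F, ∃ n : 𝔭, X n z = u
  base : ∀ (w : 𝔨) (y : 𝔭), m z (X w z) (X y z) = Q w (G y)

variable {m : F → F →L[ℝ] F →L[ℝ] ℝ} {z : F} {b : 𝔨 → 𝔨 → 𝔨} {X : 𝔨 → F → F}
  {Q : LinearMap.BilinForm ℝ 𝔨} {𝔭 : Submodule ℝ 𝔨} {G : Module.End ℝ 𝔭}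

omit [CompleteSpace F] in
lemma IsInfinitesimalModel.eq_zero (h : IsInfinitesimalModel m z b X Q 𝔭 G) {u : F}
    (hu : ∀ n : 𝔭, m z u (X n z) = 0) : u = 0 := by
  obtain ⟨n, hn⟩ := h.surj u
  by_contra h0
  have h1 := h.pos u h0
  have h2 := hu n
  rw [hn] at h2
  linarith

omit [CompleteSpace F] in
lemma IsInfinitesimalModel.koszul (h : IsInfinitesimalModel m z b X Q 𝔭 G) {x y : 𝔭} {lam : ℝ}
    (hx : G x = lam • x) (hxy : b x (G y) = 0) (n : 𝔭) :
    2 * m z (cov m (X y) z (X x z)) (X n z) = - (Q (b x y) (G n) + lam * Q (b x y) n) := by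
  have hk := koszul_killing h.metric (h.killing x).self_of_nhds (h.killing y).self_of_nhds
    (h.killing n).self_of_nhds ((h.contDiffAt x).differentiableAt (by norm_num))
    ((h.contDiffAt y).differentiableAt (by norm_num))
  rw [hk, (h.bracket _ _).self_of_nhds, (h.bracket _ _).self_of_nhds,
    (h.bracket _ _).self_of_nhds]
  simp only [map_neg, neg_apply, h.base]
  rw [h.metric.symm.self_of_nhds (X x z), h.base, hx]
  have e1 := h.ad_invariant x n (G y)
  rw [h.swap x n, hxy] at e1
  have e2 := h.ad_invariant y n x
  rw [h.swap y n, h.swap y x] at e2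
  have e3 := h.symm (b x y) n
  simp only [map_neg, LinearMap.neg_apply, map_zero, Submodule.coe_smul, map_smul, smul_eq_mul] at *
  linear_combination -e1 - lam * e2 + lam * e3

omit [CompleteSpace F] in
lemma IsInfinitesimalModel.cov_self (h : IsInfinitesimalModel m z b X Q 𝔭 G) {x : 𝔭} {lam : ℝ}
    (hx : G x = lam • x) : cov m (X x) z (X x z) = 0 := by
  refine h.eq_zero fun n ↦ ?_
  have hk := koszul_killing h.metric (h.killing x).self_of_nhds (h.killing x).self_of_nhds
    (h.killing n).self_of_nhds ((h.contDiffAt x).differentiableAt (by norm_num))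
    ((h.contDiffAt x).differentiableAt (by norm_num))
  rw [h.metric.symm.self_of_nhds (X x z) (lieBracket ℝ _ _ _),
    (h.bracket n x).self_of_nhds, lieBracket_self] at hk
  have e1 := h.ad_invariant x n x
  have e2 : Q (n : 𝔨) (b x x) = 0 := by
    have := congrArg (Q (n : 𝔨)) (h.swap x x)
    rw [map_neg] at this
    linarith
  rw [e2, h.swap x n] at e1
  simp only [map_neg, LinearMap.neg_apply, neg_apply, h.base, hx, Submodule.coe_smul, map_smul,
    smul_eq_mul, Pi.zero_apply, map_zero, zero_apply] at hk e1
  linear_combination hk / 2 - lam * e1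

/-- If `G x = λ x` and `[x, G y] = 0`, then the numerator of the sectional curvature of `x` and `y`
is `|∇_X Y|² - |[x, y]|²`. -/
lemma IsInfinitesimalModel.curvature_eq (h : IsInfinitesimalModel m z b X Q 𝔭 G) {x y : 𝔭}
    {lam : ℝ} (hx : G x = lam • x) (hxy : b x (G y) = 0) :
    m z (riemannCoord m z (X x z) (X y z) (X y z)) (X x z) =
      m z (cov m (X y) z (X x z)) (cov m (X y) z (X x z))
        - m z (X (b x y) z) (X (b x y) z) := by
  rw [curvature_killing h.metric (h.killing x) (h.killing y) (h.contDiffAt x) (h.contDiffAt y)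
    (h.cov_self hx)]
  have e1 : lieBracket ℝ (X x) (lieBracket ℝ (X x) (X y)) z = X (b x (b x y)) z := by
    have h1 : lieBracket ℝ (X x) (X y) =ᶠ[𝓝 z] fun z' ↦ - X (b x y) z' := h.bracket x y
    have h2 := (h.bracket x (b x y)).self_of_nhds
    rw [lieBracket] at h2 ⊢
    rw [h1.fderiv_eq, h1.self_of_nhds, fderiv_fun_neg]
    simp only [neg_apply, map_neg]
    rw [← neg_inj, ← h2]
    abel
  have e2 := h.ad_invariant x (b x y) (G y)
  rw [hxy, map_zero, add_zero] at e2
  rw [e1, h.base, e2, (h.bracket x y).self_of_nhds]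
  simp

lemma IsInfinitesimalModel.curvature_eq_zero (h : IsInfinitesimalModel m z b X Q 𝔭 G)
    (hQ : ∀ x, x ≠ 0 → 0 < Q x x) {x y : 𝔭}
    {lam lam' : ℝ} (hx : G x = lam • x) (hy : G y = lam' • y) (hxy : b x y = 0) :
    m z (riemannCoord m z (X x z) (X y z) (X y z)) (X x z) = 0 := by
  have hxGy : b x (G y) = 0 := by
    by_contra h0
    have e1 := h.ad_invariant x (G y) (b x (G y))
    have e2 := h.ad_invariant x y (b x (G y))
    have e3 := hQ _ h0
    simp only [hy, hxy, Submodule.coe_smul, map_smul, LinearMap.smul_apply, smul_eq_mul, map_zero,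
      LinearMap.zero_apply, zero_add] at e1 e2 e3
    rw [e2] at e1
    linarith
  have hc : cov m (X y) z (X x z) = 0 := by
    refine h.eq_zero fun n ↦ ?_
    have := h.koszul hx hxGy n
    simp only [hxy, map_zero, LinearMap.zero_apply] at this
    linarith
  have h0 : X (b x y) z = 0 := by
    refine h.eq_zero fun n ↦ ?_
    simp [h.base, hxy]
  rw [h.curvature_eq hx hxGy, hc, h0]
  simp

lemma IsInfinitesimalModel.curvature_nonpos (h : IsInfinitesimalModel m z b X Q 𝔭 G)
    (hQ : ∀ n : 𝔭, 0 ≤ Q n n) (hG : ∀ n n' : 𝔭, Q (G n) n' = Q n (G n'))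
    {x y : 𝔭} {lam : ℝ} (hlam : 0 ≤ lam) (hleast : ∀ n : 𝔭, lam * Q n n ≤ Q (G n) n)
    (hproj : ∀ w : 𝔨, ∃ n : 𝔭, X w z = X n z ∧ ∀ n' : 𝔭, Q w n' = Q n n')
    (hx : G x = lam • x) (hxy : b x (G y) = 0) :
    m z (riemannCoord m z (X x z) (X y z) (X y z)) (X x z) ≤ 0 := by
  rw [h.curvature_eq hx hxy]
  obtain ⟨w, hw, hw'⟩ := hproj (b x y)
  obtain ⟨n, hn⟩ := h.surj (cov m (X y) z (X x z))
  have hk := h.koszul hx hxy n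
  rw [← hn, h.base, hw', hw'] at hk
  rw [← hn, hw, h.base, h.base]
  -- `Q (G u) u + λ Q u u` is nonnegative at `u = w + n`, and at most `2 Q (G u) u` at `w` and `n`
  have e1 := hleast n
  have e2 := hleast w
  have e3 := hleast (w + n)
  have e4 := mul_nonneg hlam (hQ (w + n))
  have e5 := hG w n
  have e6 := hG n n
  have e7 := hG w w
  have e8 := hG n w
  have e9 := h.symm (n : 𝔨) w
  have e10 := h.symm (G n : 𝔨) w
  have e11 := h.symm (G w : 𝔨) n
  simp only [map_add, Submodule.coe_add, LinearMap.add_apply] at e3 e4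
  nlinarith

end Algebra

/-! ### Charts and submersions -/

section Charts

open Filter Topology VectorField

variable {E : Type*} [NormedAddCommGroup E] [NormedSpace ℝ E]
  {F : Type*} [NormedAddCommGroup F] [NormedSpace ℝ F]
  {M : Type*} [TopologicalSpace M] [ChartedSpace E M]
  {N : Type*} [TopologicalSpace N] [ChartedSpace F N]

lemma contMDiffAt_extChartAt_symm [IsManifold 𝓘(ℝ, E) ∞ M] (p : M) {z : E}
    (hz : z ∈ (extChartAt 𝓘(ℝ, E) p).target) :
    ContMDiffAt 𝓘(ℝ, E) 𝓘(ℝ, E) ∞ (extChartAt 𝓘(ℝ, E) p).symm z :=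
  (contMDiffOn_extChartAt_symm p).contMDiffAt ((isOpen_extChartAt_target p).mem_nhds hz)

lemma contMDiffAt_extChartAt_of_mem [IsManifold 𝓘(ℝ, E) ∞ M] (p : M) {x : M}
    (hx : x ∈ (extChartAt 𝓘(ℝ, E) p).source) :
    ContMDiffAt 𝓘(ℝ, E) 𝓘(ℝ, E) ∞ (extChartAt 𝓘(ℝ, E) p) x :=
  contMDiffAt_extChartAt' (by rwa [extChartAt_source] at hx)

/-- The manifold derivative is the derivative of the coordinate expression in the preferred
charts. -/
lemma mfderiv_eq_fderiv_extChartAt {f : M → N} {x : M}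
    (hf : MDifferentiableAt 𝓘(ℝ, E) 𝓘(ℝ, F) f x) :
    (mfderiv 𝓘(ℝ, E) 𝓘(ℝ, F) f x : E →L[ℝ] F) =
      fderiv ℝ (extChartAt 𝓘(ℝ, F) (f x) ∘ f ∘ (extChartAt 𝓘(ℝ, E) x).symm)
        (extChartAt 𝓘(ℝ, E) x x) := by
  refine hf.mfderiv.trans ?_
  simp only [writtenInExtChartAt, modelWithCornersSelf_coe, Set.range_id, fderivWithin_univ]
  rfl

lemma mfderiv_eq_fderiv_comp_symm {f : M → F} {x : M}
    (hf : MDifferentiableAt 𝓘(ℝ, E) 𝓘(ℝ, F) f x) :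
    (mfderiv 𝓘(ℝ, E) 𝓘(ℝ, F) f x : E →L[ℝ] F) =
      fderiv ℝ (f ∘ (extChartAt 𝓘(ℝ, E) x).symm) (extChartAt 𝓘(ℝ, E) x x) := by
  rw [mfderiv_eq_fderiv_extChartAt hf]
  rfl

/-- A submersion has a smooth local section through every point. -/
lemma exists_local_section [IsManifold 𝓘(ℝ, E) ∞ M] [IsManifold 𝓘(ℝ, F) ∞ N] {f : M → N}
    (hf : IsSubmersion 𝓘(ℝ, E) 𝓘(ℝ, F) ∞ f) (x : M) :
    ∃ σ : N → M, ContMDiffAt 𝓘(ℝ, F) 𝓘(ℝ, E) ∞ σ (f x) ∧ σ (f x) = x ∧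
      ∀ᶠ y in 𝓝 (f x), f (σ y) = y := by
  obtain h := hf.isSubmersionOfComplement_complement x
  set dc := h.domChart
  set cc := h.codChart
  set L := h.equiv
  have hx : x ∈ dc.source := h.mem_domChart_source
  have hfx : f x ∈ cc.source := h.mem_codChart_source
  have hW (u : E) (hu : u ∈ dc.target) : cc (f (dc.symm u)) = (L u).1 := by
    have := h.writtenInCharts
      (show u ∈ (h.domChart.extend 𝓘(ℝ, E)).target by simpa using hu)
    simpa using this
  let τ : N → E := fun y ↦ L.symm (cc y, (L (dc x)).2)
  have hτ0 : τ (f x) = dc x := by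
    have h1 := hW (dc x) (dc.map_source hx)
    rw [dc.left_inv hx] at h1
    simp only [τ, h1]
    exact L.symm_apply_apply _
  have hcc : ContMDiffAt 𝓘(ℝ, F) 𝓘(ℝ, F) ∞ cc (f x) :=
    contMDiffAt_of_mem_maximalAtlas h.codChart_mem_maximalAtlas hfx
  have hτ : ContMDiffAt 𝓘(ℝ, F) 𝓘(ℝ, E) ∞ τ (f x) := by
    have h1 : ContDiff ℝ ∞ (fun y : F ↦ L.symm (y, (L (dc x)).2)) :=
      L.symm.contDiff.comp (contDiff_id.prodMk contDiff_const)
    exact h1.contMDiff.contMDiffAt.comp (f x) hcc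
  have hdc : ContMDiffAt 𝓘(ℝ, E) 𝓘(ℝ, E) ∞ dc.symm (τ (f x)) := by
    rw [hτ0]
    exact contMDiffAt_symm_of_mem_maximalAtlas h.domChart_mem_maximalAtlas (dc.map_source hx)
  have hmem : ∀ᶠ y in 𝓝 (f x), τ y ∈ dc.target := by
    refine hτ.continuousAt.eventually (dc.open_target.mem_nhds ?_)
    rw [hτ0]; exact dc.map_source hx
  refine ⟨dc.symm ∘ τ, hdc.comp (f x) hτ, ?_, ?_⟩
  · simp [hτ0, dc.left_inv hx]
  · filter_upwards [hmem, cc.open_source.mem_nhds hfx] with y h1 h2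
    refine cc.injOn (h.source_subset_preimage_source (dc.map_target h1)) h2 ?_
    rw [hW _ h1]
    simp [τ]

lemma surjective_mfderiv_of_isSubmersion [IsManifold 𝓘(ℝ, E) ∞ M] [IsManifold 𝓘(ℝ, F) ∞ N]
    {f : M → N} (hf : IsSubmersion 𝓘(ℝ, E) 𝓘(ℝ, F) ∞ f) (x : M) :
    Function.Surjective (mfderiv 𝓘(ℝ, E) 𝓘(ℝ, F) f x) := by
  obtain ⟨σ, hσ, hσ0, hσf⟩ := exists_local_section hf x
  have h1 : MDifferentiableAt 𝓘(ℝ, F) 𝓘(ℝ, E) σ (f x) := hσ.mdifferentiableAt (by simp)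
  have h2 : MDifferentiableAt 𝓘(ℝ, E) 𝓘(ℝ, F) f (σ (f x)) :=
    hf.contMDiff.contMDiffAt.mdifferentiableAt (by simp)
  have h3 := HasMFDerivAt.comp (f x) h2.hasMFDerivAt h1.hasMFDerivAt
  have h4 : HasMFDerivAt 𝓘(ℝ, F) 𝓘(ℝ, F) id (f x) _ :=
    h3.congr_of_eventuallyEq (hσf.mono fun y h ↦ h.symm)
  have h5 := hasMFDerivAt_unique h4 (hasMFDerivAt_id (f x))
  intro u
  have h6 := congrArg (fun T : F →L[ℝ] F ↦ T u) h5
  have key (y : M) (hy : y = x) (w : E) (hw : (mfderiv 𝓘(ℝ, E) 𝓘(ℝ, F) f y : E →L[ℝ] F) w = u) :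
      ∃ w, mfderiv 𝓘(ℝ, E) 𝓘(ℝ, F) f x w = u := by
    subst hy
    exact ⟨w, hw⟩
  exact key _ hσ0 _ h6

end Charts

/-! ### The metric in a chart -/

section Metric

open Filter Topology

variable {F : Type*} [NormedAddCommGroup F] [NormedSpace ℝ F]
  {M : Type*} [TopologicalSpace M] [ChartedSpace F M] [IsManifold 𝓘(ℝ, F) ∞ M]
  (g : ContMDiffRiemannianMetric 𝓘(ℝ, F) ∞ F (fun m : M ↦ TangentSpace 𝓘(ℝ, F) m)) (p : M)

lemma metricCoord_self (u v : F) :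
    metricCoord g p (extChartAt 𝓘(ℝ, F) p p) u v =
      g.inner p (u : TangentSpace 𝓘(ℝ, F) p) (v : TangentSpace 𝓘(ℝ, F) p) := by
  have h := mfderivWithin_range_extChartAt_symm (I := 𝓘(ℝ, F)) (x := p)
  simp only [modelWithCornersSelf_coe, Set.range_id, mfderivWithin_univ] at h
  have h' (u : F) : (mfderiv 𝓘(ℝ, F) 𝓘(ℝ, F) (extChartAt 𝓘(ℝ, F) p).symm
      (extChartAt 𝓘(ℝ, F) p p) : F →L[ℝ] F) u = u := congrArg (fun T : F →L[ℝ] F ↦ T u) h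
  let B : M → F →L[ℝ] F →L[ℝ] ℝ := fun m ↦ g.inner m
  change B ((extChartAt 𝓘(ℝ, F) p).symm (extChartAt 𝓘(ℝ, F) p p))
    ((mfderiv 𝓘(ℝ, F) 𝓘(ℝ, F) (extChartAt 𝓘(ℝ, F) p).symm
      (extChartAt 𝓘(ℝ, F) p p) : F →L[ℝ] F) u)
    ((mfderiv 𝓘(ℝ, F) 𝓘(ℝ, F) (extChartAt 𝓘(ℝ, F) p).symm
      (extChartAt 𝓘(ℝ, F) p p) : F →L[ℝ] F) v) = B p u v
  rw [h', h', extChartAt_to_inv]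

lemma contMDiffAt_mfderiv_extChartAt_symm {z : F} (hz : z ∈ (extChartAt 𝓘(ℝ, F) p).target)
    (u : F) :
    ContMDiffAt 𝓘(ℝ, F) (𝓘(ℝ, F).prod 𝓘(ℝ, F)) ∞
      (fun z' ↦ TotalSpace.mk' F (E := fun m : M ↦ TangentSpace 𝓘(ℝ, F) m)
        ((extChartAt 𝓘(ℝ, F) p).symm z')
        (mfderiv 𝓘(ℝ, F) 𝓘(ℝ, F) (extChartAt 𝓘(ℝ, F) p).symm z' u)) z := by
  have ho := isOpen_extChartAt_target (I := 𝓘(ℝ, F)) p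
  have h1 := (contMDiffOn_extChartAt_symm (n := ∞) (I := 𝓘(ℝ, F)) p).contMDiffOn_tangentMapWithin
    (m := ∞) (by simp) ho.uniqueMDiffOn
  have h2 : ContMDiffAt 𝓘(ℝ, F) (𝓘(ℝ, F).prod 𝓘(ℝ, F)) ∞
      (fun z' ↦ (⟨z', u⟩ : TangentBundle 𝓘(ℝ, F) F)) z :=
    (contMDiffAt_vectorSpace_iff_contDiffAt (V := fun _ ↦ u)).mpr contDiffAt_const
  have h3 := (h1.contMDiffAt (x := (⟨z, u⟩ : TangentBundle 𝓘(ℝ, F) F)) ?_).comp z h2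
  · refine h3.congr_of_eventuallyEq ?_
    filter_upwards [ho.mem_nhds hz] with z' hz'
    simp only [Function.comp_apply, tangentMapWithin]
    rw [mfderivWithin_of_isOpen ho hz']
  · exact (FiberBundle.continuous_proj F (TangentSpace 𝓘(ℝ, F))).continuousAt.preimage_mem_nhds
      (ho.mem_nhds hz)

lemma contDiffOn_metricCoord [FiniteDimensional ℝ F] :
    ContDiffOn ℝ ∞ (metricCoord g p) (extChartAt 𝓘(ℝ, F) p).target := by
  rw [contDiffOn_clm_apply]
  intro u
  rw [contDiffOn_clm_apply]
  intro v z hz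
  refine ContDiffAt.contDiffWithinAt ?_
  rw [← contMDiffAt_iff_contDiffAt]
  have hb := contMDiffAt_extChartAt_symm p hz
  have hψ := g.contMDiff.contMDiffAt.comp z hb
  have key := ContMDiffAt.clm_bundle_apply₂ (F₁ := F) (F₂ := F) (F₃ := ℝ)
    (E₁ := fun m : M ↦ TangentSpace 𝓘(ℝ, F) m) (E₂ := fun m : M ↦ TangentSpace 𝓘(ℝ, F) m)
    (E₃ := Bundle.Trivial M ℝ) (b := (extChartAt 𝓘(ℝ, F) p).symm)
    (ψ := fun z' ↦ g.inner ((extChartAt 𝓘(ℝ, F) p).symm z'))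
    hψ (contMDiffAt_mfderiv_extChartAt_symm p hz u) (contMDiffAt_mfderiv_extChartAt_symm p hz v)
  rw [contMDiffAt_totalSpace] at key
  exact key.2

lemma isLocalMetric_metricCoord [FiniteDimensional ℝ F] :
    IsLocalMetric (metricCoord g p) (extChartAt 𝓘(ℝ, F) p p) := by
  refine ⟨?_, ?_, ?_⟩
  · exact contDiffAt_infty.mp
      ((contDiffOn_metricCoord g p).contDiffAt (extChartAt_target_mem_nhds p)) 2
  · exact Eventually.of_forall fun z u v ↦ g.symm _ _ _
  · have hinj : Function.Injective (metricCoord g p (extChartAt 𝓘(ℝ, F) p p)) := by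
      rw [injective_iff_map_eq_zero]
      intro u hu
      by_contra h0
      have h1 := g.pos p u h0
      rw [← metricCoord_self g p u u, hu] at h1
      simp at h1
    have hdim : Module.finrank ℝ F = Module.finrank ℝ (F →L[ℝ] ℝ) := by
      rw [← (LinearMap.toContinuousLinearMap (𝕜 := ℝ) (E := F) (F' := ℝ)).finrank_eq]
      exact (Subspace.dual_finrank_eq).symm
    let e := LinearEquiv.ofInjectiveOfFinrankEq
      (metricCoord g p (extChartAt 𝓘(ℝ, F) p p) : F →ₗ[ℝ] F →L[ℝ] ℝ) hinj hdim
    refine ⟨e.toContinuousLinearEquiv, ?_⟩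
    ext u v
    rfl

end Metric

/-! ### Lie groups in a chart -/

section GroupCoordinates

open Filter Topology VectorField

variable {E : Type*} [NormedAddCommGroup E] [NormedSpace ℝ E]
  {K : Type*} [TopologicalSpace K] [ChartedSpace E K] [Group K]

variable (E K) in
/-- The multiplication of `K` in the preferred chart at `1`. -/
noncomputable def coordMul (p : E × E) : E :=
  extChartAt 𝓘(ℝ, E) (1 : K)
    ((extChartAt 𝓘(ℝ, E) (1 : K)).symm p.1 * (extChartAt 𝓘(ℝ, E) (1 : K)).symm p.2)

variable (E K) in
/-- Conjugation `(k, l) ↦ k l k⁻¹` in the preferred chart at `1`. -/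
noncomputable def coordConj (p : E × E) : E :=
  extChartAt 𝓘(ℝ, E) (1 : K)
    ((extChartAt 𝓘(ℝ, E) (1 : K)).symm p.1 * (extChartAt 𝓘(ℝ, E) (1 : K)).symm p.2 *
      ((extChartAt 𝓘(ℝ, E) (1 : K)).symm p.1)⁻¹)

variable (E K) in
/-- The coordinates of `1` in the preferred chart at `1`. -/
noncomputable def coordOne : E := extChartAt 𝓘(ℝ, E) (1 : K) (1 : K)

lemma extChartAt_symm_coordOne :
    (extChartAt 𝓘(ℝ, E) (1 : K)).symm (coordOne E K) = 1 := extChartAt_to_inv _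

lemma coordOne_mem : coordOne E K ∈ (extChartAt 𝓘(ℝ, E) (1 : K)).target :=
  mem_extChartAt_target _

lemma target_mem_nhds_coordOne :
    (extChartAt 𝓘(ℝ, E) (1 : K)).target ∈ 𝓝 (coordOne E K) := extChartAt_target_mem_nhds _

lemma coordMul_one : ∀ᶠ e in 𝓝 (coordOne E K), coordMul E K (e, coordOne E K) = e := by
  filter_upwards [target_mem_nhds_coordOne (E := E) (K := K)] with e he
  rw [coordMul, extChartAt_symm_coordOne, mul_one, PartialEquiv.right_inv _ he]

lemma one_coordMul : ∀ᶠ e in 𝓝 (coordOne E K), coordMul E K (coordOne E K, e) = e := by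
  filter_upwards [target_mem_nhds_coordOne (E := E) (K := K)] with e he
  rw [coordMul, extChartAt_symm_coordOne, one_mul, PartialEquiv.right_inv _ he]

lemma coordConj_one :
    ∀ᶠ e in 𝓝 (coordOne E K), coordConj E K (e, coordOne E K) = coordOne E K := by
  filter_upwards with e
  rw [coordConj, extChartAt_symm_coordOne, mul_one, mul_inv_cancel, coordOne]

lemma one_coordConj : ∀ᶠ e in 𝓝 (coordOne E K), coordConj E K (coordOne E K, e) = e := by
  filter_upwards [target_mem_nhds_coordOne (E := E) (K := K)] with e he
  rw [coordConj, extChartAt_symm_coordOne, one_mul, inv_one, mul_one, PartialEquiv.right_inv _ he]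

variable [LieGroup 𝓘(ℝ, E) ∞ K]

lemma contMDiffAt_symm_fst {G : Type*} [NormedAddCommGroup G] [NormedSpace ℝ G] (z : G) :
    ContMDiffAt 𝓘(ℝ, E × G) 𝓘(ℝ, E) ∞
      (fun p : E × G ↦ (extChartAt 𝓘(ℝ, E) (1 : K)).symm p.1) (coordOne E K, z) :=
  ContMDiffAt.comp (I' := 𝓘(ℝ, E)) (coordOne E K, z)
    (contMDiffAt_extChartAt_symm (1 : K) (z := coordOne E K) coordOne_mem)
    contDiffAt_fst.contMDiffAt

lemma contMDiffAt_symm_snd :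
    ContMDiffAt 𝓘(ℝ, E × E) 𝓘(ℝ, E) ∞
      (fun p : E × E ↦ (extChartAt 𝓘(ℝ, E) (1 : K)).symm p.2) (coordOne E K, coordOne E K) :=
  ContMDiffAt.comp (I' := 𝓘(ℝ, E)) (coordOne E K, coordOne E K)
    (contMDiffAt_extChartAt_symm (1 : K) (z := coordOne E K) coordOne_mem)
    contDiffAt_snd.contMDiffAt

lemma contMDiffAt_symm_mul_symm :
    ContMDiffAt 𝓘(ℝ, E × E) 𝓘(ℝ, E) ∞
      (fun p : E × E ↦ (extChartAt 𝓘(ℝ, E) (1 : K)).symm p.1 *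
        (extChartAt 𝓘(ℝ, E) (1 : K)).symm p.2) (coordOne E K, coordOne E K) :=
  (contMDiffAt_symm_fst _).mul contMDiffAt_symm_snd

lemma contDiffAt_coordMul :
    ContDiffAt ℝ ∞ (coordMul E K) (coordOne E K, coordOne E K) := by
  rw [← contMDiffAt_iff_contDiffAt]
  refine ContMDiffAt.comp (I' := 𝓘(ℝ, E)) (coordOne E K, coordOne E K)
    (contMDiffAt_extChartAt_of_mem (1 : K) ?_) contMDiffAt_symm_mul_symm
  simp only [extChartAt_symm_coordOne, mul_one]
  exact mem_extChartAt_source _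

lemma contMDiffAt_symm_conj_symm :
    ContMDiffAt 𝓘(ℝ, E × E) 𝓘(ℝ, E) ∞
      (fun p : E × E ↦ (extChartAt 𝓘(ℝ, E) (1 : K)).symm p.1 *
        (extChartAt 𝓘(ℝ, E) (1 : K)).symm p.2 * ((extChartAt 𝓘(ℝ, E) (1 : K)).symm p.1)⁻¹)
      (coordOne E K, coordOne E K) :=
  contMDiffAt_symm_mul_symm.mul (contMDiffAt_symm_fst _).inv

lemma contDiffAt_coordConj :
    ContDiffAt ℝ ∞ (coordConj E K) (coordOne E K, coordOne E K) := by
  rw [← contMDiffAt_iff_contDiffAt]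
  refine ContMDiffAt.comp (I' := 𝓘(ℝ, E)) (coordOne E K, coordOne E K)
    (contMDiffAt_extChartAt_of_mem (1 : K) ?_) contMDiffAt_symm_conj_symm
  simp only [extChartAt_symm_coordOne, mul_one, inv_one]
  exact mem_extChartAt_source _

lemma coordMul_coordConj : ∀ᶠ p in 𝓝 (coordOne E K, coordOne E K),
    coordMul E K (coordConj E K p, p.1) = coordMul E K p := by
  have h1 : ∀ᶠ p in 𝓝 (coordOne E K, coordOne E K),
      (extChartAt 𝓘(ℝ, E) (1 : K)).symm p.1 * (extChartAt 𝓘(ℝ, E) (1 : K)).symm p.2 *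
        ((extChartAt 𝓘(ℝ, E) (1 : K)).symm p.1)⁻¹ ∈ (extChartAt 𝓘(ℝ, E) (1 : K)).source := by
    refine contMDiffAt_symm_conj_symm.continuousAt.eventually ?_
    simp only [extChartAt_symm_coordOne, mul_one, inv_one]
    exact extChartAt_source_mem_nhds _
  filter_upwards [h1] with p hp
  rw [coordMul, coordConj, PartialEquiv.left_inv _ hp, coordMul]
  congr 1
  group

lemma mulInvariantVectorField_coord (v : E) {e : E}
    (he : e ∈ (extChartAt 𝓘(ℝ, E) (1 : K)).target) :
    (mfderiv 𝓘(ℝ, E) 𝓘(ℝ, E) (extChartAt 𝓘(ℝ, E) (1 : K))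
      ((extChartAt 𝓘(ℝ, E) (1 : K)).symm e) : E →L[ℝ] E)
      (mulInvariantVectorField (I := 𝓘(ℝ, E)) (G := K) v
        ((extChartAt 𝓘(ℝ, E) (1 : K)).symm e)) =
      leftField (coordMul E K) (coordOne E K) v e := by
  set k := (extChartAt 𝓘(ℝ, E) (1 : K)).symm e with hk
  have hk1 : k ∈ (extChartAt 𝓘(ℝ, E) (1 : K)).source := PartialEquiv.map_target _ he
  have h1 : MDifferentiableAt 𝓘(ℝ, E) 𝓘(ℝ, E) (fun l : K ↦ k * l) 1 :=
    (contMDiff_mul_left (n := ∞) (I := 𝓘(ℝ, E)) (a := k)).contMDiffAt.mdifferentiableAt (by simp)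
  have h2 : MDifferentiableAt 𝓘(ℝ, E) 𝓘(ℝ, E) (extChartAt 𝓘(ℝ, E) (1 : K)) (k * 1) := by
    rw [mul_one]
    exact (contMDiffAt_extChartAt_of_mem (1 : K) hk1).mdifferentiableAt (by simp)
  have h3 := mfderiv_comp (1 : K) h2 h1
  have h4 := mfderiv_eq_fderiv_comp_symm (h2.comp (1 : K) h1)
  have h5 := congrArg (fun T : E →L[ℝ] E ↦ T v) (h3.symm.trans h4)
  have key (l : K) (hl : l = k) (w : E) :
      (mfderiv 𝓘(ℝ, E) 𝓘(ℝ, E) (extChartAt 𝓘(ℝ, E) (1 : K)) l : E →L[ℝ] E) w =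
      (mfderiv 𝓘(ℝ, E) 𝓘(ℝ, E) (extChartAt 𝓘(ℝ, E) (1 : K)) k : E →L[ℝ] E) w := by
    rw [hl]
  exact (key (k * 1) (mul_one k) _).symm.trans h5

lemma mpullback_mulInvariantVectorField_coord (v : E) {e : E}
    (he : e ∈ (extChartAt 𝓘(ℝ, E) (1 : K)).target) :
    mpullbackWithin 𝓘(ℝ, E) 𝓘(ℝ, E) (extChartAt 𝓘(ℝ, E) (1 : K)).symm
      (mulInvariantVectorField (I := 𝓘(ℝ, E)) (G := K) v) Set.univ e =
      leftField (coordMul E K) (coordOne E K) v e := by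
  have h1 := mfderiv_extChartAt_comp_mfderivWithin_extChartAt_symm (I := 𝓘(ℝ, E)) he
  have h2 := mfderivWithin_extChartAt_symm_comp_mfderiv_extChartAt (I := 𝓘(ℝ, E)) he
  have h3 := ContinuousLinearMap.inverse_eq h2 h1
  rw [← mulInvariantVectorField_coord v he, mpullbackWithin_apply]
  simp only [modelWithCornersSelf_coe, Set.range_id] at h3
  exact congrArg (fun T : E →L[ℝ] E ↦ T _) h3

/-- The bracket of the Lie algebra, computed in the preferred chart at `1`. -/
lemma bracket_eq_lieBracket (v w : GroupLieAlgebra 𝓘(ℝ, E) K) :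
    (⁅v, w⁆ : GroupLieAlgebra 𝓘(ℝ, E) K) =
      lieBracket ℝ (leftField (coordMul E K) (coordOne E K) v)
        (leftField (coordMul E K) (coordOne E K) w) (coordOne E K) := by
  rw [GroupLieAlgebra.bracket_def, mlieBracket, mlieBracketWithin_apply]
  have h1 := mfderiv_extChartAt_self (I := 𝓘(ℝ, E)) (x := (1 : K))
  let V (v : E) : E → E := mpullbackWithin 𝓘(ℝ, E) 𝓘(ℝ, E) (extChartAt 𝓘(ℝ, E) (1 : K)).symm
      (mulInvariantVectorField (I := 𝓘(ℝ, E)) (G := K) v) Set.univ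
  have hev (v : E) : V v =ᶠ[𝓝 (coordOne E K)]
      leftField (coordMul E K) (coordOne E K) v := by
    filter_upwards [target_mem_nhds_coordOne (E := E) (K := K)] with e he
    exact mpullback_mulInvariantVectorField_coord v he
  have h2 : lieBracketWithin ℝ (V v) (V w) Set.univ (coordOne E K) =
      lieBracket ℝ (leftField (coordMul E K) (coordOne E K) v)
        (leftField (coordMul E K) (coordOne E K) w) (coordOne E K) := by
    rw [lieBracketWithin_univ]
    exact (hev v).lieBracket_vectorField_eq (𝕜 := ℝ) (hev w)
  have h3 : ∀ u : E, (mfderiv 𝓘(ℝ, E) 𝓘(ℝ, E) (extChartAt 𝓘(ℝ, E) (1 : K)) (1 : K)).inverse u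
      = u := by
    intro u
    have : (mfderiv 𝓘(ℝ, E) 𝓘(ℝ, E) (extChartAt 𝓘(ℝ, E) (1 : K)) (1 : K) :
        E →L[ℝ] E).inverse = ContinuousLinearMap.id ℝ E :=
      (congrArg (fun T : E →L[ℝ] E ↦ T.inverse) h1).trans ContinuousLinearMap.inverse_id
    exact congrArg (fun T : E →L[ℝ] E ↦ T u) this
  refine (h3 _).trans ?_
  simp only [modelWithCornersSelf_coe, Set.range_id, Set.preimage_univ, Set.inter_univ]
  exact h2

/-- The adjoint action in the preferred chart at `1`. -/
lemma lieAd_eq_leftField (e : E) (x : E) :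
    (lieAd (E := E) ((extChartAt 𝓘(ℝ, E) (1 : K)).symm e) : E →L[ℝ] E) x =
      leftField (coordConj E K) (coordOne E K) x e := by
  set k := (extChartAt 𝓘(ℝ, E) (1 : K)).symm e with hk
  have h1 : MDifferentiableAt 𝓘(ℝ, E) 𝓘(ℝ, E) (fun a : K ↦ k * a * k⁻¹) 1 := by
    have : ContMDiff 𝓘(ℝ, E) 𝓘(ℝ, E) ∞ (fun a : K ↦ k * a * k⁻¹) :=
      (contMDiff_const.mul contMDiff_id).mul contMDiff_const
    exact this.contMDiffAt.mdifferentiableAt (by simp)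
  have h2 := mfderiv_eq_fderiv_extChartAt h1
  have h3 : k * 1 * k⁻¹ = 1 := by group
  rw [h3] at h2
  exact congrArg (fun T : E →L[ℝ] E ↦ T x) h2

/-- Infinitesimal form of the `Ad`-invariance of a bilinear form, in coordinates. -/
lemma apply_lieBracket_add_apply_lieBracket {B : E →L[ℝ] E →L[ℝ] ℝ}
    (hB : ∀ e x y, B (leftField (coordConj E K) (coordOne E K) x e)
      (leftField (coordConj E K) (coordOne E K) y e) = B x y) (v x y : E) :
    B (lieBracket ℝ (leftField (coordMul E K) (coordOne E K) v)
        (leftField (coordMul E K) (coordOne E K) x) (coordOne E K)) y +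
      B x (lieBracket ℝ (leftField (coordMul E K) (coordOne E K) v)
        (leftField (coordMul E K) (coordOne E K) y) (coordOne E K)) = 0 := by
  have hμ : ContDiffAt ℝ 2 (coordMul E K) (coordOne E K, coordOne E K) :=
    contDiffAt_infty.mp contDiffAt_coordMul 2
  have hc : ContDiffAt ℝ 2 (coordConj E K) (coordOne E K, coordOne E K) :=
    contDiffAt_infty.mp contDiffAt_coordConj 2
  have hA (x : E) : DifferentiableAt ℝ (leftField (coordConj E K) (coordOne E K) x)
      (coordOne E K) := (fderiv_partial_snd_fst hc x).1
  have hA0 (x : E) : leftField (coordConj E K) (coordOne E K) x (coordOne E K) = x := by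
    rw [leftField, EventuallyEq.fderiv_eq (f := id) one_coordConj]; simp
  rw [← fderiv_conj hμ hc coordMul_one one_coordMul coordConj_one one_coordConj
      coordMul_coordConj v x, ← fderiv_conj hμ hc coordMul_one one_coordMul coordConj_one
      one_coordConj coordMul_coordConj v y]
  have h : HasFDerivAt (fun e ↦ B (leftField (coordConj E K) (coordOne E K) x e)
      (leftField (coordConj E K) (coordOne E K) y e)) _ (coordOne E K) :=
    (B.hasFDerivAt.comp (coordOne E K) (hA x).hasFDerivAt).clm_apply (hA y).hasFDerivAt
  simp only [hB] at h
  have h2 := congrArg (fun T : E →L[ℝ] ℝ ↦ T v) (h.unique (hasFDerivAt_const _ _))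
  simp [hA0] at h2
  linarith

/-- Infinitesimal form of the `Ad`-invariance of a bilinear form. -/
lemma ad_invariant [FiniteDimensional ℝ E] {Q : LinearMap.BilinForm ℝ (GroupLieAlgebra 𝓘(ℝ, E) K)}
    (hQ : ∀ (k : K) x y, Q (lieAd k x) (lieAd k y) = Q x y)
    (v x y : GroupLieAlgebra 𝓘(ℝ, E) K) : Q ⁅v, x⁆ y + Q x ⁅v, y⁆ = 0 := by
  let B : E →L[ℝ] E →L[ℝ] ℝ := LinearMap.toContinuousBilinearMap (𝕜 := ℝ) (E := E) (F := E) Q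
  have hB (e x y : E) : B (leftField (coordConj E K) (coordOne E K) x e)
      (leftField (coordConj E K) (coordOne E K) y e) = B x y := by
    rw [← lieAd_eq_leftField, ← lieAd_eq_leftField]
    exact hQ _ _ _
  rw [bracket_eq_lieBracket, bracket_eq_lieBracket]
  exact apply_lieBracket_add_apply_lieBracket hB v x y

end GroupCoordinates

/-! ### The action on the homogeneous space in charts -/

section ActionCoordinates

open Filter Topology VectorField

variable {E : Type*} [NormedAddCommGroup E] [NormedSpace ℝ E]
  {K : Type*} [TopologicalSpace K] [ChartedSpace E K] [Group K]
  {F : Type*} [NormedAddCommGroup F] [NormedSpace ℝ F]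
  {H : Subgroup K} [ChartedSpace F (K ⧸ H)]

variable (E F H) in
/-- The action of `K` on `K ⧸ H` in the preferred charts at `1` and at the base point. -/
noncomputable def coordAct (p : E × F) : F :=
  extChartAt 𝓘(ℝ, F) (basePoint H)
    ((extChartAt 𝓘(ℝ, E) (1 : K)).symm p.1 • (extChartAt 𝓘(ℝ, F) (basePoint H)).symm p.2)

variable (F H) in
/-- The coordinates of the base point in the preferred chart there. -/
noncomputable def coordBase : F := extChartAt 𝓘(ℝ, F) (basePoint H) (basePoint H)

lemma extChartAt_symm_coordBase :
    (extChartAt 𝓘(ℝ, F) (basePoint H)).symm (coordBase F H) = basePoint H := extChartAt_to_inv _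

lemma coordBase_mem : coordBase F H ∈ (extChartAt 𝓘(ℝ, F) (basePoint H)).target :=
  mem_extChartAt_target _

lemma target_mem_nhds_coordBase :
    (extChartAt 𝓘(ℝ, F) (basePoint H)).target ∈ 𝓝 (coordBase F H) := extChartAt_target_mem_nhds _

lemma one_coordAct :
    ∀ᶠ z in 𝓝 (coordBase F H), coordAct E F H (coordOne E K, z) = z := by
  filter_upwards [target_mem_nhds_coordBase (F := F) (H := H)] with z hz
  rw [coordAct, extChartAt_symm_coordOne, one_smul, PartialEquiv.right_inv _ hz]

variable [LieGroup 𝓘(ℝ, E) ∞ K] [IsManifold 𝓘(ℝ, F) ∞ (K ⧸ H)]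

lemma contMDiff_smul_left
    (hπ : IsSubmersion 𝓘(ℝ, E) 𝓘(ℝ, F) ∞ (QuotientGroup.mk : K → K ⧸ H)) (k : K) :
    ContMDiff 𝓘(ℝ, F) 𝓘(ℝ, F) ∞ (fun m : K ⧸ H ↦ k • m) := by
  intro m
  obtain ⟨l, rfl⟩ := QuotientGroup.mk_surjective m
  obtain ⟨σ, hσ, hσ0, hσπ⟩ := exists_local_section hπ l
  have h1 : ContMDiffAt 𝓘(ℝ, F) 𝓘(ℝ, F) ∞ (fun m : K ⧸ H ↦ ((k * σ m : K) : K ⧸ H))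
      (l : K ⧸ H) :=
    hπ.contMDiff.contMDiffAt.comp (l : K ⧸ H)
      ((contMDiff_mul_left (I := 𝓘(ℝ, E)) (a := k)).contMDiffAt.comp (l : K ⧸ H) hσ)
  refine h1.congr_of_eventuallyEq ?_
  filter_upwards [hσπ] with m hm
  conv_lhs => rw [← hm]
  rfl

lemma contMDiffAt_symm_smul_symm
    (hπ : IsSubmersion 𝓘(ℝ, E) 𝓘(ℝ, F) ∞ (QuotientGroup.mk : K → K ⧸ H)) :
    ContMDiffAt 𝓘(ℝ, E × F) 𝓘(ℝ, F) ∞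
      (fun p : E × F ↦ (extChartAt 𝓘(ℝ, E) (1 : K)).symm p.1 •
        (extChartAt 𝓘(ℝ, F) (basePoint H)).symm p.2) (coordOne E K, coordBase F H) := by
  obtain ⟨σ, hσ, hσ0, hσπ⟩ := exists_local_section hπ (1 : K)
  have h0 : ContMDiffAt 𝓘(ℝ, E × F) 𝓘(ℝ, F) ∞
      (fun p : E × F ↦ (extChartAt 𝓘(ℝ, F) (basePoint H)).symm p.2)
      (coordOne E K, coordBase F H) :=
    ContMDiffAt.comp (I' := 𝓘(ℝ, F)) (coordOne E K, coordBase F H)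
      (contMDiffAt_extChartAt_symm (basePoint H) (z := coordBase F H) coordBase_mem)
      contDiffAt_snd.contMDiffAt
  have h1 : ContMDiffAt 𝓘(ℝ, E × F) 𝓘(ℝ, E) ∞
      (fun p : E × F ↦ σ ((extChartAt 𝓘(ℝ, F) (basePoint H)).symm p.2))
      (coordOne E K, coordBase F H) := by
    refine ContMDiffAt.comp (I' := 𝓘(ℝ, F)) (coordOne E K, coordBase F H) ?_ h0
    rw [extChartAt_symm_coordBase]
    exact hσ
  have h2 : ContMDiffAt 𝓘(ℝ, E × F) 𝓘(ℝ, F) ∞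
      (fun p : E × F ↦ (((extChartAt 𝓘(ℝ, E) (1 : K)).symm p.1 *
        σ ((extChartAt 𝓘(ℝ, F) (basePoint H)).symm p.2) : K) : K ⧸ H))
      (coordOne E K, coordBase F H) :=
    ContMDiffAt.comp (I' := 𝓘(ℝ, E)) (coordOne E K, coordBase F H) hπ.contMDiff.contMDiffAt
      ((contMDiffAt_symm_fst _).mul h1)
  refine h2.congr_of_eventuallyEq ?_
  have h3 : ∀ᶠ p in 𝓝 (coordOne E K, coordBase F H),
      QuotientGroup.mk (s := H) (σ ((extChartAt 𝓘(ℝ, F) (basePoint H)).symm p.2)) =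
        (extChartAt 𝓘(ℝ, F) (basePoint H)).symm p.2 := by
    refine h0.continuousAt.eventually (p := fun y ↦ QuotientGroup.mk (σ y) = y) ?_
    simp only [extChartAt_symm_coordBase]
    exact hσπ
  filter_upwards [h3] with p hp
  conv_lhs => rw [← hp]
  rfl

lemma contDiffAt_coordAct
    (hπ : IsSubmersion 𝓘(ℝ, E) 𝓘(ℝ, F) ∞ (QuotientGroup.mk : K → K ⧸ H)) :
    ContDiffAt ℝ ∞ (coordAct E F H) (coordOne E K, coordBase F H) := by
  rw [← contMDiffAt_iff_contDiffAt]
  refine ContMDiffAt.comp (I' := 𝓘(ℝ, F)) (coordOne E K, coordBase F H)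
    (contMDiffAt_extChartAt_of_mem (basePoint H) ?_) (contMDiffAt_symm_smul_symm hπ)
  simp only [extChartAt_symm_coordOne, one_smul, extChartAt_symm_coordBase]
  exact mem_extChartAt_source _

lemma symm_smul_symm_mem_source
    (hπ : IsSubmersion 𝓘(ℝ, E) 𝓘(ℝ, F) ∞ (QuotientGroup.mk : K → K ⧸ H)) :
    ∀ᶠ p in 𝓝 (coordOne E K, coordBase F H),
      (extChartAt 𝓘(ℝ, E) (1 : K)).symm p.1 • (extChartAt 𝓘(ℝ, F) (basePoint H)).symm p.2 ∈
        (extChartAt 𝓘(ℝ, F) (basePoint H)).source := by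
  refine (contMDiffAt_symm_smul_symm hπ).continuousAt.eventually ?_
  simp only [extChartAt_symm_coordOne, one_smul, extChartAt_symm_coordBase]
  exact extChartAt_source_mem_nhds _

lemma coordMul_coordAct
    (hπ : IsSubmersion 𝓘(ℝ, E) 𝓘(ℝ, F) ∞ (QuotientGroup.mk : K → K ⧸ H)) :
    ∀ᶠ p in 𝓝 ((coordOne E K, coordOne E K), coordBase F H),
      coordAct E F H (coordMul E K p.1, p.2) =
        coordAct E F H (p.1.1, coordAct E F H (p.1.2, p.2)) := by
  have h1 : ∀ᶠ p in 𝓝 (coordOne E K, coordOne E K),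
      (extChartAt 𝓘(ℝ, E) (1 : K)).symm p.1 * (extChartAt 𝓘(ℝ, E) (1 : K)).symm p.2 ∈
        (extChartAt 𝓘(ℝ, E) (1 : K)).source := by
    refine contMDiffAt_symm_mul_symm.continuousAt.eventually ?_
    simp only [extChartAt_symm_coordOne, mul_one]
    exact extChartAt_source_mem_nhds _
  have t1 : Tendsto (fun p : (E × E) × F ↦ p.1) (𝓝 ((coordOne E K, coordOne E K), coordBase F H))
      (𝓝 (coordOne E K, coordOne E K)) := continuous_fst.tendsto _
  have t2 : Tendsto (fun p : (E × E) × F ↦ (p.1.2, p.2))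
      (𝓝 ((coordOne E K, coordOne E K), coordBase F H)) (𝓝 (coordOne E K, coordBase F H)) :=
    ((continuous_snd.comp continuous_fst).prodMk continuous_snd).tendsto _
  filter_upwards [t1.eventually h1, t2.eventually (symm_smul_symm_mem_source hπ)] with p h1 h2
  simp only [coordAct, coordMul]
  rw [PartialEquiv.left_inv _ h1, PartialEquiv.left_inv _ h2, mul_smul]

omit [LieGroup 𝓘(ℝ, E) ∞ K] [IsManifold 𝓘(ℝ, F) ∞ (K ⧸ H)] in
/-- The fundamental fields of the action, at the base point, are given by the differential of the
projection. -/
lemma fundamentalField_coordBase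
    (hπ : IsSubmersion 𝓘(ℝ, E) 𝓘(ℝ, F) ∞ (QuotientGroup.mk : K → K ⧸ H)) (v : E) :
    fundamentalField (coordAct E F H) (coordOne E K) v (coordBase F H) =
      (projDifferential E F H : E →L[ℝ] F) v := by
  have h1 : MDifferentiableAt 𝓘(ℝ, E) 𝓘(ℝ, F) (QuotientGroup.mk : K → K ⧸ H) 1 :=
    hπ.contMDiff.contMDiffAt.mdifferentiableAt (by simp)
  have h2 := congrArg (fun T : E →L[ℝ] F ↦ T v) (mfderiv_eq_fderiv_extChartAt h1)
  refine Eq.trans ?_ h2.symm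
  simp only [fundamentalField, coordAct, extChartAt_symm_coordBase]
  congr 2
  funext e
  simp only [Function.comp_apply]
  congr 1
  change ((_ * 1 : K) : K ⧸ H) = _
  rw [mul_one]

/-- The action preserves the coordinate expression of an invariant metric. -/
lemma metricCoord_coordAct
    (hπ : IsSubmersion 𝓘(ℝ, E) 𝓘(ℝ, F) ∞ (QuotientGroup.mk : K → K ⧸ H))
    (g : ContMDiffRiemannianMetric 𝓘(ℝ, F) ∞ F (fun m : K ⧸ H ↦ TangentSpace 𝓘(ℝ, F) m))
    (hg : ∀ (k : K) (m : K ⧸ H) (u v : TangentSpace 𝓘(ℝ, F) m),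
      g.inner (k • m) (mfderiv 𝓘(ℝ, F) 𝓘(ℝ, F) (fun m' : K ⧸ H ↦ k • m') m u)
        (mfderiv 𝓘(ℝ, F) 𝓘(ℝ, F) (fun m' : K ⧸ H ↦ k • m') m v) = g.inner m u v) :
    ∀ᶠ p in 𝓝 (coordOne E K, coordBase F H), ∀ u v,
      metricCoord g (basePoint H) (coordAct E F H p)
        (fderiv ℝ (fun z ↦ coordAct E F H (p.1, z)) p.2 u)
        (fderiv ℝ (fun z ↦ coordAct E F H (p.1, z)) p.2 v) =
      metricCoord g (basePoint H) p.2 u v := by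
  have t2 : Tendsto (fun p : E × F ↦ p.2) (𝓝 (coordOne E K, coordBase F H)) (𝓝 (coordBase F H)) :=
    continuous_snd.tendsto _
  filter_upwards [(symm_smul_symm_mem_source hπ).eventually_nhds, symm_smul_symm_mem_source hπ,
    t2.eventually target_mem_nhds_coordBase] with ⟨e, z⟩ h1 h2 h3 u v
  simp only at h1 h2 h3 ⊢
  set k : K := (extChartAt 𝓘(ℝ, E) (1 : K)).symm e
  let Φ : F → K ⧸ H := fun z ↦ (extChartAt 𝓘(ℝ, F) (basePoint H)).symm z
  let A : F → F := fun z ↦ coordAct E F H (e, z)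
  have tz : Tendsto (fun z' : F ↦ (e, z')) (𝓝 z) (𝓝 (e, z)) :=
    (continuous_const.prodMk continuous_id).tendsto z
  have hΦA : ∀ᶠ z' in 𝓝 z, Φ (A z') = k • Φ z' := by
    filter_upwards [tz.eventually h1] with z' hz'
    exact PartialEquiv.left_inv _ hz'
  have hAz : A z ∈ (extChartAt 𝓘(ℝ, F) (basePoint H)).target := PartialEquiv.map_source _ h2
  have dΦ : MDifferentiableAt 𝓘(ℝ, F) 𝓘(ℝ, F) Φ z :=
    (contMDiffAt_extChartAt_symm (basePoint H) h3).mdifferentiableAt (by simp)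
  have dΦA : MDifferentiableAt 𝓘(ℝ, F) 𝓘(ℝ, F) Φ (A z) :=
    (contMDiffAt_extChartAt_symm (basePoint H) hAz).mdifferentiableAt (by simp)
  have dk : MDifferentiableAt 𝓘(ℝ, F) 𝓘(ℝ, F) (fun m : K ⧸ H ↦ k • m) (Φ z) :=
    (contMDiff_smul_left hπ k).contMDiffAt.mdifferentiableAt (by simp)
  have dA : MDifferentiableAt 𝓘(ℝ, F) 𝓘(ℝ, F) A z :=
    ((contMDiffAt_extChartAt_of_mem (basePoint H) h2).mdifferentiableAt (by simp)).comp z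
      (dk.comp z dΦ)
  have e1 := HasMFDerivAt.comp z dΦA.hasMFDerivAt dA.hasMFDerivAt
  have e2 := HasMFDerivAt.comp z dk.hasMFDerivAt dΦ.hasMFDerivAt
  have e3 : HasMFDerivAt 𝓘(ℝ, F) 𝓘(ℝ, F) (Φ ∘ A) z _ := e2.congr_of_eventuallyEq hΦA
  have e4 := hasMFDerivAt_unique e1 e3
  rw [mfderiv_eq_fderiv] at e4
  let B : K ⧸ H → F →L[ℝ] F →L[ℝ] ℝ := fun m ↦ g.inner m
  have e5 (u : F) : (mfderiv 𝓘(ℝ, F) 𝓘(ℝ, F) Φ (A z) : F →L[ℝ] F) (fderiv ℝ A z u) =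
      (mfderiv 𝓘(ℝ, F) 𝓘(ℝ, F) (fun m : K ⧸ H ↦ k • m) (Φ z) : F →L[ℝ] F)
        ((mfderiv 𝓘(ℝ, F) 𝓘(ℝ, F) Φ z : F →L[ℝ] F) u) :=
    congrArg (fun T : F →L[ℝ] F ↦ T u) e4
  change B (Φ (A z)) ((mfderiv 𝓘(ℝ, F) 𝓘(ℝ, F) Φ (A z) : F →L[ℝ] F) (fderiv ℝ A z u))
    ((mfderiv 𝓘(ℝ, F) 𝓘(ℝ, F) Φ (A z) : F →L[ℝ] F) (fderiv ℝ A z v)) =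
    B (Φ z) ((mfderiv 𝓘(ℝ, F) 𝓘(ℝ, F) Φ z : F →L[ℝ] F) u)
      ((mfderiv 𝓘(ℝ, F) 𝓘(ℝ, F) Φ z : F →L[ℝ] F) v)
  rw [e5, e5, hΦA.self_of_nhds]
  exact hg k (Φ z) _ _

/-- In coordinates, the action generates a family of Killing fields of an invariant metric. -/
lemma isKillingFamily_fundamentalField [FiniteDimensional ℝ F]
    (hπ : IsSubmersion 𝓘(ℝ, E) 𝓘(ℝ, F) ∞ (QuotientGroup.mk : K → K ⧸ H))
    (g : ContMDiffRiemannianMetric 𝓘(ℝ, F) ∞ F (fun m : K ⧸ H ↦ TangentSpace 𝓘(ℝ, F) m))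
    (hg : ∀ (k : K) (m : K ⧸ H) (u v : TangentSpace 𝓘(ℝ, F) m),
      g.inner (k • m) (mfderiv 𝓘(ℝ, F) 𝓘(ℝ, F) (fun m' : K ⧸ H ↦ k • m') m u)
        (mfderiv 𝓘(ℝ, F) 𝓘(ℝ, F) (fun m' : K ⧸ H ↦ k • m') m v) = g.inner m u v) :
    IsKillingFamily (𝔨 := GroupLieAlgebra 𝓘(ℝ, E) K) (metricCoord g (basePoint H))
      (coordBase F H) (fun v w ↦ ⁅v, w⁆)
      (fun v ↦ fundamentalField (coordAct E F H) (coordOne E K) v) := by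
  have hm : IsLocalMetric (metricCoord g (basePoint H)) (coordBase F H) :=
    isLocalMetric_metricCoord g _
  have : CompleteSpace F := FiniteDimensional.complete ℝ F
  have hμ : ContDiffAt ℝ 2 (coordMul E K) (coordOne E K, coordOne E K) :=
    contDiffAt_infty.mp contDiffAt_coordMul 2
  have ha : ContDiffAt ℝ 2 (coordAct E F H) (coordOne E K, coordBase F H) :=
    contDiffAt_infty.mp (contDiffAt_coordAct hπ) 2
  have t1 : Tendsto (fun z : F ↦ (coordOne E K, z)) (𝓝 (coordBase F H))
      (𝓝 (coordOne E K, coordBase F H)) := (continuous_const.prodMk continuous_id).tendsto _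
  have t2 : Tendsto (fun z : F ↦ ((coordOne E K, coordOne E K), z)) (𝓝 (coordBase F H))
      (𝓝 ((coordOne E K, coordOne E K), coordBase F H)) :=
    (continuous_const.prodMk continuous_id).tendsto _
  have ha' := t1.eventually (ha.eventually (by simp))
  refine ⟨hm, fun v ↦ contDiffAt_fundamentalField
    (contDiffAt_infty.mp (contDiffAt_coordAct hπ) 3) v, fun v ↦ ?_, fun v w ↦ ?_⟩
  · filter_upwards [ha', hm.eventually, (one_coordAct (E := E) (F := F) (H := H)).eventually_nhds,
      t1.eventually (metricCoord_coordAct hπ g hg).eventually_nhds] with z h1 h2 h3 h4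
    have t3 : Tendsto (fun e : E ↦ (e, z)) (𝓝 (coordOne E K)) (𝓝 (coordOne E K, z)) :=
      (continuous_id.prodMk continuous_const).tendsto _
    exact isKillingAt_fundamentalField h2.differentiableAt h1 h3 (t3.eventually h4) v
  · filter_upwards [ha', one_coordAct (E := E) (F := F) (H := H),
      t2.eventually (coordMul_coordAct hπ).eventually_nhds] with z h1 h2 h3
    rw [lieBracket_fundamentalField h1 hμ coordMul_one one_coordMul h2 h3 v w,
      bracket_eq_lieBracket]

end ActionCoordinates

/-! ### The isotropy decomposition -/

section Isotropy

open Filter Topology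

/-- If the `Q`-orthogonal complement of a subset of the kernel of `ρ` meets the kernel trivially,
then it is the orthogonal complement of the whole kernel. -/
lemma exists_mem_orthogonal_of_injOn {𝔨 W : Type*} [AddCommGroup 𝔨] [Module ℝ 𝔨]
    [FiniteDimensional ℝ 𝔨] [AddCommGroup W] [Module ℝ W] (ρ : 𝔨 →ₗ[ℝ] W)
    {Q : LinearMap.BilinForm ℝ 𝔨} (symm : ∀ x y, Q x y = Q y x)
    (pos : ∀ x, x ≠ 0 → 0 < Q x x) {𝔭 : Submodule ℝ 𝔨} {𝔥 : Set 𝔨}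
    (h𝔭 : ∀ x, (∀ v ∈ 𝔥, Q x v = 0) → x ∈ 𝔭) (h𝔥 : ∀ v ∈ 𝔥, ρ v = 0)
    (hinj : ∀ x ∈ 𝔭, ρ x = 0 → x = 0) (w : 𝔨) :
    ∃ n : 𝔭, ρ w = ρ n ∧ ∀ n' : 𝔭, Q w n' = Q n n' := by
  have hrefl : Q.IsRefl := fun x y h ↦ by rw [symm, h]
  have hcompl : IsCompl (LinearMap.ker ρ) (Q.orthogonal (LinearMap.ker ρ)) := by
    rw [LinearMap.BilinForm.isCompl_orthogonal_iff_disjoint hrefl, Submodule.disjoint_def]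
    intro x hx hx'
    by_contra h0
    exact (pos x h0).ne' (hx' x hx)
  have hle : Q.orthogonal (LinearMap.ker ρ) ≤ 𝔭 := fun x hx ↦ h𝔭 x fun v hv ↦ by
    rw [symm]; exact hx v (h𝔥 v hv)
  have hdim : Module.finrank ℝ 𝔭 ≤ Module.finrank ℝ (Q.orthogonal (LinearMap.ker ρ)) := by
    have h1 : Module.finrank ℝ 𝔭 ≤ Module.finrank ℝ (LinearMap.range ρ) := by
      refine LinearMap.finrank_le_finrank_of_injective (f := ρ.rangeRestrict ∘ₗ 𝔭.subtype) ?_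
      rw [injective_iff_map_eq_zero]
      intro x hx
      exact Subtype.ext (hinj x x.2 (congrArg Subtype.val hx))
    have h2 := ρ.finrank_range_add_finrank_ker
    have h3 := Submodule.finrank_add_eq_of_isCompl hcompl
    omega
  have heq := Submodule.eq_of_le_of_finrank_le hle hdim
  obtain ⟨v, hv, n, hn, rfl⟩ := Submodule.mem_sup.mp
    (hcompl.sup_eq_top ▸ Submodule.mem_top : w ∈ LinearMap.ker ρ ⊔ Q.orthogonal (LinearMap.ker ρ))
  refine ⟨⟨n, hle hn⟩, ?_, fun n' ↦ ?_⟩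
  · rw [map_add, LinearMap.mem_ker.mp hv, zero_add]
  · have h1 : Q v n' = 0 := (heq ▸ n'.2 : (n' : 𝔨) ∈ Q.orthogonal (LinearMap.ker ρ)) v hv
    simp [h1]

variable {E : Type*} [NormedAddCommGroup E] [NormedSpace ℝ E]
  {K : Type*} [TopologicalSpace K] [ChartedSpace E K] [Group K]
  {F : Type*} [NormedAddCommGroup F] [NormedSpace ℝ F]
  {H : Subgroup K} [ChartedSpace F (K ⧸ H)]

/-- The projection is constant along one-parameter subgroups of `H`. -/
lemma projDifferential_eq_zero [IsManifold 𝓘(ℝ, F) ∞ (K ⧸ H)]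
    (hπ : ContMDiff 𝓘(ℝ, E) 𝓘(ℝ, F) ∞ (QuotientGroup.mk : K → K ⧸ H))
    {v : GroupLieAlgebra 𝓘(ℝ, E) K} (hv : v ∈ subgroupLieAlgebra H) :
    (projDifferential E F H : E →L[ℝ] F) v = 0 := by
  obtain ⟨γ, h0, hγ, hH⟩ := hv
  have h1 : MDifferentiableAt 𝓘(ℝ, E) 𝓘(ℝ, F) (QuotientGroup.mk : K → K ⧸ H) (γ 0) :=
    hπ.contMDiffAt.mdifferentiableAt (by simp)
  have h2 := HasMFDerivAt.comp 0 h1.hasMFDerivAt (hγ 0)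
  have h3 : (QuotientGroup.mk : K → K ⧸ H) ∘ γ = fun _ ↦ basePoint H := by
    funext t
    refine (QuotientGroup.eq.mpr ?_).symm
    simpa using hH t
  rw [h3] at h2
  have h4 := congrArg (fun T : ℝ →L[ℝ] F ↦ T 1)
    (hasMFDerivAt_unique h2 (hasMFDerivAt_const (basePoint H) (0 : ℝ)))
  have h5 : (mfderiv 𝓘(ℝ, E) 𝓘(ℝ, F) (QuotientGroup.mk : K → K ⧸ H) (γ 0) : E →L[ℝ] F)
      (mulInvariantVectorField (I := 𝓘(ℝ, E)) (G := K) v (γ 0)) = 0 := by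
    have h6 : (mfderiv 𝓘(ℝ, E) 𝓘(ℝ, F) (QuotientGroup.mk : K → K ⧸ H) (γ 0) : E →L[ℝ] F)
      ((1 : ℝ) • (mulInvariantVectorField (I := 𝓘(ℝ, E)) (G := K) v (γ 0) : E)) = 0 := h4
    rwa [one_smul] at h6
  have key (k : K) (hk : k = 1)
      (h : (mfderiv 𝓘(ℝ, E) 𝓘(ℝ, F) (QuotientGroup.mk : K → K ⧸ H) k : E →L[ℝ] F)
        (mulInvariantVectorField (I := 𝓘(ℝ, E)) (G := K) v k) = 0) :
      (projDifferential E F H : E →L[ℝ] F) v = 0 := by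
    subst hk
    have h7 : (mulInvariantVectorField (I := 𝓘(ℝ, E)) (G := K) v 1 : E) = v := by
      have h8 : (fun a : K ↦ 1 * a) = id := by funext a; simp
      rw [mulInvariantVectorField]
      rw [h8]
      have h9 := mfderiv_id (I := 𝓘(ℝ, E)) (x := (1 : K))
      exact congrArg (fun T : E →L[ℝ] E ↦ T v) h9
    rw [h7] at h
    exact h
  exact key _ h0 h5

variable [LieGroup 𝓘(ℝ, E) ∞ K] [IsManifold 𝓘(ℝ, F) ∞ (K ⧸ H)]
  [FiniteDimensional ℝ E] [FiniteDimensional ℝ F]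
  {Q : LinearMap.BilinForm ℝ (GroupLieAlgebra 𝓘(ℝ, E) K)}
  {G : Module.End ℝ (isotropyComplement Q H)}
  {g : ContMDiffRiemannianMetric 𝓘(ℝ, F) ∞ F (fun m : K ⧸ H ↦ TangentSpace 𝓘(ℝ, F) m)}

omit [FiniteDimensional ℝ E] [FiniteDimensional ℝ F] [LieGroup 𝓘(ℝ, E) ∞ K] in
lemma projDifferential_injOn (hG : IsMetricEndomorphism Q H G) (hg : IsInducedMetric Q G g)
    (x : isotropyComplement Q H) (hx : (projDifferential E F H : E →L[ℝ] F) x = 0) : x = 0 := by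
  by_contra h0
  have h1 := hg.base x x
  have h2 : projDifferential E F H x = 0 := hx
  rw [h2, map_zero] at h1
  have h3 := hG.pos x h0
  rw [← h1] at h3
  exact lt_irrefl _ h3

omit [FiniteDimensional ℝ F] [LieGroup 𝓘(ℝ, E) ∞ K] in
/-- The decomposition of the Lie algebra of `K` into `𝔭` and the kernel of the differential of the
projection. -/
lemma exists_isotropyComplement
    (hπ : IsSubmersion 𝓘(ℝ, E) 𝓘(ℝ, F) ∞ (QuotientGroup.mk : K → K ⧸ H))
    (hQ : IsBiinvariant Q) (hG : IsMetricEndomorphism Q H G) (hg : IsInducedMetric Q G g)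
    (w : GroupLieAlgebra 𝓘(ℝ, E) K) :
    ∃ n : isotropyComplement Q H, (projDifferential E F H : E →L[ℝ] F) w =
      (projDifferential E F H : E →L[ℝ] F) n ∧
      ∀ n' : isotropyComplement Q H, Q w n' = Q n n' := by
  have : FiniteDimensional ℝ (GroupLieAlgebra 𝓘(ℝ, E) K) := inferInstanceAs (FiniteDimensional ℝ E)
  exact exists_mem_orthogonal_of_injOn (𝔭 := isotropyComplement Q H)
    (𝔥 := subgroupLieAlgebra H)
    (projDifferential E F H : E →L[ℝ] F).toLinearMap
    hQ.symm hQ.pos (fun x hx ↦ hx) (fun v hv ↦ projDifferential_eq_zero hπ.contMDiff hv)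
    (fun x hx h0 ↦ congrArg Subtype.val (projDifferential_injOn hG hg ⟨x, hx⟩ h0)) w

/-- The chart at the base point realizes the infinitesimal model given by `Q` and `G`. -/
lemma isInfinitesimalModel
    (hπ : IsSubmersion 𝓘(ℝ, E) 𝓘(ℝ, F) ∞ (QuotientGroup.mk : K → K ⧸ H))
    (hQ : IsBiinvariant Q) (hG : IsMetricEndomorphism Q H G) (hg : IsInducedMetric Q G g) :
    IsInfinitesimalModel (metricCoord g (basePoint H)) (coordBase F H)
      (fun v w : GroupLieAlgebra 𝓘(ℝ, E) K ↦ ⁅v, w⁆)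
      (fun v ↦ fundamentalField (coordAct E F H) (coordOne E K) v) Q (isotropyComplement Q H) G where
  toIsKillingFamily := isKillingFamily_fundamentalField hπ g hg.invariant
  pos u hu := by
    have := metricCoord_self g (basePoint H) u u
    rw [coordBase, this]
    exact g.pos _ u hu
  swap v w := VectorField.mlieBracket_swap_apply
  symm := hQ.symm
  ad_invariant := ad_invariant hQ.ad_invariant
  surj u := by
    obtain ⟨w, hw⟩ := surjective_mfderiv_of_isSubmersion hπ (1 : K) u
    obtain ⟨n, hn, -⟩ := exists_isotropyComplement hπ hQ hG hg w
    refine ⟨n, ?_⟩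
    exact (fundamentalField_coordBase hπ _).trans (hn.symm.trans hw)
  base w y := by
    obtain ⟨n, hn, hn'⟩ := exists_isotropyComplement hπ hQ hG hg w
    rw [hn', ← hG.selfadjoint, ← hg.base]
    exact (congrArg₂ (fun a b ↦ metricCoord g (basePoint H) (coordBase F H) a b)
      ((fundamentalField_coordBase hπ _).trans hn) (fundamentalField_coordBase hπ _)).trans
      (metricCoord_self g (basePoint H) _ _)

omit [FiniteDimensional ℝ E] [FiniteDimensional ℝ F] [LieGroup 𝓘(ℝ, E) ∞ K] in
lemma sectionalCurvature_eq
    (hπ : IsSubmersion 𝓘(ℝ, E) 𝓘(ℝ, F) ∞ (QuotientGroup.mk : K → K ⧸ H))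
    (x y : GroupLieAlgebra 𝓘(ℝ, E) K) :
    sectionalCurvature g (basePoint H) (projDifferential E F H x) (projDifferential E F H y) =
      sectionalCoord (metricCoord g (basePoint H)) (coordBase F H)
        (fundamentalField (coordAct E F H) (coordOne E K) x (coordBase F H))
        (fundamentalField (coordAct E F H) (coordOne E K) y (coordBase F H)) := by
  have h := mfderiv_extChartAt_self (I := 𝓘(ℝ, F)) (x := basePoint H)
  have h' (u : F) : (mfderiv 𝓘(ℝ, F) 𝓘(ℝ, F) (extChartAt 𝓘(ℝ, F) (basePoint H)) (basePoint H) :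
      F →L[ℝ] F) u = u := congrArg (fun T : F →L[ℝ] F ↦ T u) h
  exact congrArg₂ (sectionalCoord (metricCoord g (basePoint H)) (coordBase F H))
    ((h' _).trans (fundamentalField_coordBase hπ x).symm)
    ((h' _).trans (fundamentalField_coordBase hπ y).symm)

omit [FiniteDimensional ℝ E] [FiniteDimensional ℝ F] [LieGroup 𝓘(ℝ, E) ∞ K] in
lemma linearIndependent_projDifferential (hG : IsMetricEndomorphism Q H G)
    (hg : IsInducedMetric Q G g) {x y : isotropyComplement Q H}
    (h : LinearIndependent ℝ ![x, y]) :
    LinearIndependent ℝ ![projDifferential E F H x, projDifferential E F H y] := by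
  rw [LinearIndependent.pair_iff] at h ⊢
  intro s t hst
  refine h s t (projDifferential_injOn hG hg _ ?_)
  have : projDifferential E F H ((s • x + t • y : isotropyComplement Q H) :
      GroupLieAlgebra 𝓘(ℝ, E) K) = 0 := by
    rw [Submodule.coe_add, Submodule.coe_smul, Submodule.coe_smul, map_add, map_smul, map_smul, hst]
  exact this

end Isotropy

/-- The Cauchy-Schwarz inequality. -/
lemma apply_sq_le {V : Type*} [NormedAddCommGroup V] [NormedSpace ℝ V] (B : V →L[ℝ] V →L[ℝ] ℝ)
    (symm : ∀ u v, B u v = B v u) (pos : ∀ u, u ≠ 0 → 0 < B u u) (u v : V) :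
    B u v ^ 2 ≤ B u u * B v v := by
  rcases eq_or_ne v 0 with rfl | hv
  · simp
  have hv' := pos v hv
  have h : 0 ≤ B (B v v • u - B u v • v) (B v v • u - B u v • v) := by
    rcases eq_or_ne (B v v • u - B u v • v) 0 with h0 | h0
    · simp [h0]
    · exact (pos _ h0).le
  simp only [map_sub, map_smul, sub_apply, smul_apply, smul_eq_mul, symm v u] at h
  have h2 : 0 ≤ B v v * (B u u * B v v - B u v ^ 2) := by linarith
  have := nonneg_of_mul_nonneg_right h2 hv'
  linarith

end HomogeneousCurvature

theorem lemma1
    {E : Type*} [NormedAddCommGroup E] [NormedSpace ℝ E] [FiniteDimensional ℝ E]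
    {F : Type*} [NormedAddCommGroup F] [NormedSpace ℝ F] [FiniteDimensional ℝ F]
    -- a compact Lie group `K` and a closed subgroup `H`
    {K : Type*} [TopologicalSpace K] [ChartedSpace E K] [Group K] [LieGroup 𝓘(ℝ, E) ∞ K]
    [T2Space K] [CompactSpace K]
    (H : Subgroup K) (_hH : IsClosed (H : Set K))
    -- the smooth structure on `K ⧸ H` for which the projection is a smooth submersion
    [ChartedSpace F (K ⧸ H)] [IsManifold 𝓘(ℝ, F) ∞ (K ⧸ H)]
    (_hproj : IsSubmersion 𝓘(ℝ, E) 𝓘(ℝ, F) ∞ (QuotientGroup.mk : K → K ⧸ H))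
    -- a biinvariant metric `Q`, a metric endomorphism `G` of `𝔭`, the induced metric `g`
    (Q : LinearMap.BilinForm ℝ (GroupLieAlgebra 𝓘(ℝ, E) K)) (_hQ : IsBiinvariant Q)
    (G : Module.End ℝ (isotropyComplement Q H)) (_hG : IsMetricEndomorphism Q H G)
    (g : ContMDiffRiemannianMetric 𝓘(ℝ, F) ∞ F (fun m : K ⧸ H ↦ TangentSpace 𝓘(ℝ, F) m))
    (_hg : IsInducedMetric Q G g) :
    -- (a)
    (∀ x y : isotropyComplement Q H,
      (∃ a : ℝ, G.HasEigenvector a x) → (∃ b : ℝ, G.HasEigenvector b y) →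
      LinearIndependent ℝ ![x, y] →
      ⁅(x : GroupLieAlgebra 𝓘(ℝ, E) K), (y : GroupLieAlgebra 𝓘(ℝ, E) K)⁆ = 0 →
      LinearIndependent ℝ ![projDifferential E F H x, projDifferential E F H y] ∧
      sectionalCurvature g (basePoint H) (projDifferential E F H x) (projDifferential E F H y) = 0) ∧
    -- (b)
    (∀ (lam : ℝ) (x z : isotropyComplement Q H),
      IsLeast {a : ℝ | G.HasEigenvalue a} lam → G.HasEigenvector lam x →
      LinearIndependent ℝ ![x, z] →
      ⁅(x : GroupLieAlgebra 𝓘(ℝ, E) K), (z : GroupLieAlgebra 𝓘(ℝ, E) K)⁆ = 0 →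
      ∃ y : isotropyComplement Q H, G y = z ∧
        LinearIndependent ℝ ![projDifferential E F H x, projDifferential E F H y] ∧
        sectionalCurvature g (basePoint H)
          (projDifferential E F H x) (projDifferential E F H y) ≤ 0) := by
  have : CompleteSpace F := FiniteDimensional.complete ℝ F
  have : FiniteDimensional ℝ (GroupLieAlgebra 𝓘(ℝ, E) K) := inferInstanceAs (FiniteDimensional ℝ E)
  have model := HomogeneousCurvature.isInfinitesimalModel _hproj _hQ _hG _hg
  refine ⟨fun x y ⟨a, ha⟩ ⟨b, hb⟩ hxy hbr ↦ ⟨?_, ?_⟩, fun lam x z hlam hx hxz hbr ↦ ?_⟩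
  · exact HomogeneousCurvature.linearIndependent_projDifferential _hG _hg hxy
  · rw [HomogeneousCurvature.sectionalCurvature_eq _hproj, sectionalCoord,
      model.curvature_eq_zero _hQ.pos ha.apply_eq_smul hb.apply_eq_smul hbr, zero_div]
  · have hQnn (n : isotropyComplement Q H) :
        0 ≤ Q (n : GroupLieAlgebra 𝓘(ℝ, E) K) (n : GroupLieAlgebra 𝓘(ℝ, E) K) := by
      rcases eq_or_ne (n : GroupLieAlgebra 𝓘(ℝ, E) K) 0 with h0 | h0
      · simp [h0]
      · exact (_hQ.pos _ h0).le
    have hinj : Function.Injective G := by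
      rw [injective_iff_map_eq_zero]
      intro n hn
      by_contra h0
      have := _hG.pos n h0
      rw [hn] at this
      simp at this
    have hlam0 : 0 < lam := by
      have h1 := _hG.pos x hx.2
      rw [hx.apply_eq_smul, Submodule.coe_smul, map_smul, LinearMap.smul_apply, smul_eq_mul] at h1
      exact pos_of_mul_pos_left h1 (hQnn x)
    obtain ⟨y, rfl⟩ := (LinearMap.injective_iff_surjective.mp hinj) z
    refine ⟨y, rfl, ?_, ?_⟩
    · refine HomogeneousCurvature.linearIndependent_projDifferential _hG _hg ?_
      rw [LinearIndependent.pair_iff] at hxz ⊢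
      intro s t hst
      have h1 := congrArg G hst
      rw [map_add, map_smul, map_smul, hx.apply_eq_smul, map_zero, smul_smul] at h1
      obtain ⟨h2, h3⟩ := hxz _ _ h1
      exact ⟨(mul_eq_zero.mp h2).resolve_right hlam0.ne', h3⟩
    · have hleast := HomogeneousCurvature.least_eigenvalue_mul_le
        (Q.restrict (isotropyComplement Q H)) (fun x y ↦ _hQ.symm x y)
        (fun x hx ↦ _hQ.pos x fun h ↦ hx (Subtype.ext h)) G (fun x y ↦ _hG.selfadjoint x y) hlam.2
      rw [HomogeneousCurvature.sectionalCurvature_eq _hproj, sectionalCoord]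
      refine div_nonpos_of_nonpos_of_nonneg ?_ (sub_nonneg.mpr ?_)
      · refine model.curvature_nonpos hQnn _hG.selfadjoint hlam0.le hleast (fun w ↦ ?_)
          hx.apply_eq_smul hbr
        obtain ⟨n, hn, hn'⟩ := HomogeneousCurvature.exists_isotropyComplement _hproj _hQ _hG _hg w
        refine ⟨n, ?_, hn'⟩
        exact (HomogeneousCurvature.fundamentalField_coordBase _hproj _).trans
          (hn.trans (HomogeneousCurvature.fundamentalField_coordBase _hproj _).symm)
      · exact HomogeneousCurvature.apply_sq_le _ model.metric.symm.self_of_nhds model.pos _ _
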